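/- Fix a base $b\ge 2$ and let $A_b=\{0,1,\dots,b-1\}$. It is decidable in linear time whether a minimal DFA over $A_b$ satisfies the UP-criterion. Precisely: there are a program for a random access machine (with registers and arrays, whose arithmetic is unit-cost addition and truncated subtraction) and a constant $C$, both depending on $b$ only, such that, given the number of states, the initial state, the final states and the transition table of any complete minimal DFA with states $0,\dots,n-1$, the program halts within $Cn$ steps, using only numbers smaller than $Cn$, and outputs $1$ if the DFA satisfies the UP-criterion and $0$ otherwise. Here a complete DFA $\mathcal A$ is minimal if all its states are reachable from the initial state and distinct states accept distinct languages. The condensation of $\mathcal A$ is the directed graph on its strongly connected components (SCCs), with an edge from $X$ to $Y$ whenever some transition leads from a state of $X$ to a state of $Y$; loops are disregarded when speaking of successors and leaves. An SCC is non-trivial if it contains an internal transition, of Type 1 if it contains an internal transition labelled by a digit different from $0$, and of Type 2 if it is non-trivial and not of Type 1. For $p\ge1$ coprime to $b$ and $R\subseteq\mathbb Z/p\mathbb Z$ such that $p$ is the smallest period of $\{m\in\mathbb N : m \bmod p\in R\}$, let $\psi\ge 1$ be least with $b^\psi\equiv1 \pmod p$; the Pascal automaton $\mathcal P_p^R$ has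 state set $\mathbb Z/p\mathbb Z\times\mathbb Z/\psi\mathbb Z$, initial state $(0,0)$, set of final states $R\times\mathbb Z/\psi\mathbb Z$, and transitions $(s,t)\cdot a=(s+ab^t,\,t+1)$. The DFA $\mathcal A$ satisfies the UP-criterion if the following conditions hold. * (UP-0) The successor by $0$ of a state is final if and only if that state is final. * (UP-1) Every Type 1 SCC is a leaf of the condensation. * (UP-2) Every Type 2 SCC is a simple circuit labelled by $0$ and has a unique successor in the condensation, which is a leaf. * (UP-3) Every Type 1 SCC is, for a suitable choice of initial state in it, a quotient of some Pascal automaton $\mathcal P_p^R$, that is, the image of $\mathcal P_p^R$ under a map that commutes with the transitions, and preserves and reflects finality. * (UP-4) Every Type 2 SCC $X$ is embeddable in its unique successor $Y$: there is an injection $f\colon X\to Y$ such that, for all $q\in X$ and $a\in A_b$, $f(q\cdot a)=f(q)\cdot a$ if $q\cdot a\in X$, and $f(q)\cdot a=q\cdot a$ if $q\cdot a\notin X$. -/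

import Mathlib

namespace UPC

/-! ## Automata

Complete deterministic automata are Mathlib's `DFA`; the digit alphabet in base `b` is `Fin b`. -/

section Automata

variable {α σ : Type*}

/-- The minimal automaton of its language: every state is reachable from the initial state, and
distinct states accept distinct languages. -/
def IsMinimal (A : DFA α σ) : Prop :=
  (∀ q, ∃ w, A.eval w = q) ∧ Function.Injective A.acceptsFrom

/-- The state `r` can be reached from the state `q`. -/
def Reach (A : DFA α σ) (q r : σ) : Prop := ∃ w, A.evalFrom q w = r

/-- Strong connectivity, an equivalence relation on the states. -/
def strongConn (A : DFA α σ) : Setoid σ where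
  r q r := Reach A q r ∧ Reach A r q
  iseqv :=
    { refl := fun _ => ⟨⟨[], rfl⟩, ⟨[], rfl⟩⟩
      symm := fun h => ⟨h.2, h.1⟩
      trans := by
        rintro q r s ⟨⟨u, hu⟩, ⟨v, hv⟩⟩ ⟨⟨u', hu'⟩, ⟨v', hv'⟩⟩
        exact ⟨⟨u ++ u', by rw [DFA.evalFrom_of_append, hu, hu']⟩,
          ⟨v' ++ v, by rw [DFA.evalFrom_of_append, hv', hv]⟩⟩ }

/-- The strongly connected components (SCCs) of `A`. -/
def SCC (A : DFA α σ) : Type _ := Quotient (strongConn A)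

/-- The component of a state. -/
def sccOf (A : DFA α σ) (q : σ) : SCC A := Quotient.mk (strongConn A) q

/-- The set of states of a component. -/
def states {A : DFA α σ} (x : SCC A) : Set σ := {q | sccOf A q = x}

/-- The condensation of `A`: the directed graph (with loops) on the components, with an edge from
`x` to `y` when some transition leads from a state of `x` to a state of `y`. -/
def condensation (A : DFA α σ) : Digraph (SCC A) where
  Adj x y := ∃ q ∈ states x, ∃ a, A.step q a ∈ states y

/-- `y` is a successor of `x` in the condensation, the loop at `x` being disregarded. -/
def IsSucc {A : DFA α σ} (x y : SCC A) : Prop := (condensation A).Adj x y ∧ y ≠ x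

/-- A leaf of the condensation: a vertex without successors (other than itself). -/
def IsLeaf {A : DFA α σ} (x : SCC A) : Prop := ∀ y, ¬ IsSucc x y

/-- A component is non-trivial if it contains an internal transition. -/
def Nontriv {A : DFA α σ} (x : SCC A) : Prop := ∃ q ∈ states x, ∃ a, A.step q a ∈ states x

/-- The component `x` is embeddable in the component `y`. -/
def Embeddable {A : DFA α σ} (x y : SCC A) : Prop :=
  ∃ f : states x → states y, Function.Injective f ∧ ∀ (q : states x) (a : α),
    (∀ h : A.step q a ∈ states x, (f ⟨A.step q a, h⟩ : σ) = A.step (f q) a) ∧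
    (A.step q a ∉ states x → A.step (f q) a = A.step q a)

/-- The component `x`, for a suitable choice of the initial state in it, is a quotient of the
complete automaton `P`: there is a covering of `x` by `P`, that is, a map from the states of `P` onto
those of `x` which commutes with the transitions and which preserves and reflects finality. The
initial state of `x` is the image of that of `P`. -/
def IsQuotientOf {A : DFA α σ} {τ : Type*} (x : SCC A) (P : DFA α τ) : Prop :=
  ∃ φ : τ → σ, Set.range φ = states x ∧
    (∀ q a, φ (P.step q a) = A.step (φ q) a) ∧
    (∀ q, φ q ∈ A.accept ↔ q ∈ P.accept)

end Automata

/-! ## Pascal automata -/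

/-- The set of the natural numbers whose residue modulo `p` lies in `R`. -/
def residueSet (p : ℕ) (R : Set (ZMod p)) : Set ℕ := {n | (n : ZMod p) ∈ R}

/-- `E` is periodic of period `q`. -/
def IsPeriod (E : Set ℕ) (q : ℕ) : Prop := 0 < q ∧ ∃ S : Set (ZMod q), E = residueSet q S

/-- `(p, R)` are the canonical parameters of a Pascal automaton in base `b`: `p` is coprime to `b`,
and is the smallest period of the periodic set given by `R` modulo `p`. -/
def IsPascalParam (b p : ℕ) (R : Set (ZMod p)) : Prop :=
  p.Coprime b ∧ IsLeast {q | IsPeriod (residueSet p R) q} p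

/-- The least positive `ψ` with `b ^ ψ ≡ 1` modulo `p` (for `p` positive and coprime to `b`). -/
noncomputable def psi (b p : ℕ) : ℕ := orderOf (b : ZMod p)

/-- The automaton with states `ℤ/pℤ × ℤ/ψℤ`, transitions `(s, t) · a = (s + a b ^ t, t + 1)`,
initial state `(0, 0)` and final states `R × ℤ/ψℤ`. -/
noncomputable def pascal (b p : ℕ) (R : Set (ZMod p)) : DFA (Fin b) (ZMod p × ZMod (psi b p)) where
  step x a := (x.1 + ((a : ℕ) : ZMod p) * (b : ZMod p) ^ x.2.val, x.2 + 1)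
  start := (0, 0)
  accept := {x | x.1 ∈ R}

/-! ## The UP-criterion -/

section Criterion

variable {b : ℕ} {σ : Type*}

/-- Type 1: a (non-trivial) component with an internal transition labelled by a non-zero digit. -/
def IsType1 {A : DFA (Fin b) σ} (x : SCC A) : Prop :=
  ∃ q ∈ states x, ∃ a : Fin b, (a : ℕ) ≠ 0 ∧ A.step q a ∈ states x

/-- Type 2: a non-trivial component that is not of Type 1. -/
def IsType2 {A : DFA (Fin b) σ} (x : SCC A) : Prop := Nontriv x ∧ ¬ IsType1 x

/-- The component `x` is a simple circuit `c 0 → c 1 → ... → c (ℓ - 1) → c 0` labelled by `0`, and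
has no other internal transition. -/
def IsZeroCircuit {A : DFA (Fin b) σ} (x : SCC A) : Prop :=
  ∃ ℓ : ℕ, 0 < ℓ ∧ ∃ c : ZMod ℓ → σ, Function.Injective c ∧ Set.range c = states x ∧
    ∀ i (a : Fin b), ((a : ℕ) = 0 → A.step (c i) a = c (i + 1)) ∧
      ((a : ℕ) ≠ 0 → A.step (c i) a ∉ states x)

/-- The UP-criterion for a complete deterministic automaton over the digits in base `b`. -/
structure UPCriterion (A : DFA (Fin b) σ) : Prop where
  /-- The successor by `0` of a state is final if and only if the state is. -/
  up0 : ∀ q (a : Fin b), (a : ℕ) = 0 → (A.step q a ∈ A.accept ↔ q ∈ A.accept)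
  /-- Type 1 components are leaves. -/
  up1 : ∀ x : SCC A, IsType1 x → IsLeaf x
  /-- Type 2 components are `0`-circuits -/
  up2_circuit : ∀ x : SCC A, IsType2 x → IsZeroCircuit x
  /-- and have exactly one successor, which is a leaf. -/
  up2_succ : ∀ x : SCC A, IsType2 x → ∃ y, IsSucc x y ∧ (∀ z, IsSucc x z → z = y) ∧ IsLeaf y
  /-- Type 1 components are quotients of Pascal automata. -/
  up3 : ∀ x : SCC A, IsType1 x →
    ∃ (p : ℕ) (R : Set (ZMod p)), IsPascalParam b p R ∧ IsQuotientOf x (pascal b p R)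
  /-- A Type 2 component is embeddable in its successor. -/
  up4 : ∀ x y : SCC A, IsType2 x → IsSucc x y → Embeddable x y

end Criterion

/-! ## Random access machines

Programs of a word RAM with registers and arrays, both numbered by natural numbers; a program
mentions finitely many of them. Registers and array cells hold natural numbers below a word
bound `W`. The only arithmetic operations are addition and truncated subtraction, and each
instruction and each test costs one step. -/

/-- The contents of the registers and of the arrays. -/
structure State where
  reg : ℕ → ℕ
  arr : ℕ → ℕ → ℕ

/-- Assign the value `v` to register `d`. -/
def State.setReg (s : State) (d v : ℕ) : State :=
  { s with reg := Function.update s.reg d v }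

/-- Assign the value `v` to cell `i` of array `k`. -/
def State.setArr (s : State) (k i v : ℕ) : State :=
  { s with arr := Function.update s.arr k (Function.update (s.arr k) i v) }

/-- Tests compare two registers. -/
inductive Test where
  | lt (x y : ℕ)
  | eq (x y : ℕ)

/-- The outcome of a test. -/
def Test.Holds : Test → State → Prop
  | .lt x y, s => s.reg x < s.reg y
  | .eq x y, s => s.reg x = s.reg y

/-- Programs. -/
inductive Prog where
  | skip
  /-- register `d` becomes the constant `c` -/
  | const (d c : ℕ)
  /-- register `d` becomes register `x` -/
  | copy (d x : ℕ)
  /-- register `d` becomes the sum of registers `x` and `y` -/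
  | add (d x y : ℕ)
  /-- register `d` becomes the truncated difference of registers `x` and `y` -/
  | sub (d x y : ℕ)
  /-- register `d` becomes the cell of array `k` whose index is in register `x` -/
  | load (d k x : ℕ)
  /-- the cell of array `k` whose index is in register `x` becomes register `y` -/
  | store (k x y : ℕ)
  | seq (P Q : Prog)
  | ite (e : Test) (P Q : Prog)
  | while (e : Test) (P : Prog)

/-- `Exec W P s t s'`: with word bound `W`, the program `P` started in `s` halts in `s'` after
exactly `t` steps. A computation that would produce a value not below `W` has no result. -/
inductive Exec (W : ℕ) : Prog → State → ℕ → State → Prop where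
  | skip (s) : Exec W .skip s 1 s
  | const (s d c) (h : c < W) : Exec W (.const d c) s 1 (s.setReg d c)
  | copy (s d x) : Exec W (.copy d x) s 1 (s.setReg d (s.reg x))
  | add (s d x y) (h : s.reg x + s.reg y < W) :
      Exec W (.add d x y) s 1 (s.setReg d (s.reg x + s.reg y))
  | sub (s d x y) : Exec W (.sub d x y) s 1 (s.setReg d (s.reg x - s.reg y))
  | load (s d k x) : Exec W (.load d k x) s 1 (s.setReg d (s.arr k (s.reg x)))
  | store (s k x y) : Exec W (.store k x y) s 1 (s.setArr k (s.reg x) (s.reg y))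
  | seq {P Q s s₁ s₂ t₁ t₂} (h₁ : Exec W P s t₁ s₁) (h₂ : Exec W Q s₁ t₂ s₂) :
      Exec W (.seq P Q) s (t₁ + t₂) s₂
  | ite_true {e P Q s s₁ t} (h : e.Holds s) (h₁ : Exec W P s t s₁) :
      Exec W (.ite e P Q) s (t + 1) s₁
  | ite_false {e P Q s s₁ t} (h : ¬ e.Holds s) (h₁ : Exec W Q s t s₁) :
      Exec W (.ite e P Q) s (t + 1) s₁
  | while_true {e P s s₁ s₂ t₁ t₂} (h : e.Holds s) (h₁ : Exec W P s t₁ s₁)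
      (h₂ : Exec W (.while e P) s₁ t₂ s₂) : Exec W (.while e P) s (t₁ + t₂ + 1) s₂
  | while_false {e P s} (h : ¬ e.Holds s) : Exec W (.while e P) s 1 s

/-- Programs are deterministic: the number of steps and the final contents are unique. -/
theorem Exec.unique {W : ℕ} {P : Prog} {s s₁ s₂ : State} {t₁ t₂ : ℕ}
    (h₁ : Exec W P s t₁ s₁) (h₂ : Exec W P s t₂ s₂) : t₁ = t₂ ∧ s₁ = s₂ := by
  induction h₁ generalizing t₂ s₂ with
  | seq _ _ ih ih' =>
    cases h₂ with
    | seq g g' =>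
      obtain ⟨rfl, rfl⟩ := ih g
      obtain ⟨rfl, rfl⟩ := ih' g'
      exact ⟨rfl, rfl⟩
  | ite_true h _ ih =>
    cases h₂ with
    | ite_true _ g => obtain ⟨rfl, rfl⟩ := ih g; exact ⟨rfl, rfl⟩
    | ite_false h' _ => exact absurd h h'
  | ite_false h _ ih =>
    cases h₂ with
    | ite_true h' _ => exact absurd h' h
    | ite_false _ g => obtain ⟨rfl, rfl⟩ := ih g; exact ⟨rfl, rfl⟩
  | while_true h _ _ ih ih' =>
    cases h₂ with
    | while_true _ g g' =>
      obtain ⟨rfl, rfl⟩ := ih g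
      obtain ⟨rfl, rfl⟩ := ih' g'
      exact ⟨rfl, rfl⟩
    | while_false h' => exact absurd h h'
  | while_false h =>
    cases h₂ with
    | while_true h' _ _ => exact absurd h' h
    | while_false _ => exact ⟨rfl, rfl⟩
  | _ => cases h₂; exact ⟨rfl, rfl⟩

open Classical in
/-- The input of a program: an automaton over `Fin b` with the `n` states `0, ..., n - 1`, given by
its number of states (register 0), its initial state (register 1), its final states (array 0,
with 1 for final and 0 for non-final) and its transitions by each digit `a` (array `a + 1`).
All other registers and cells hold 0. -/
noncomputable def input {b n : ℕ} (A : DFA (Fin b) (Fin n)) : State where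
  reg d := if d = 0 then n else if d = 1 then (A.start : ℕ) else 0
  arr k i :=
    if hi : i < n then
      if k = 0 then (if (⟨i, hi⟩ : Fin n) ∈ A.accept then 1 else 0)
      else if hk : k - 1 < b then (A.step ⟨i, hi⟩ ⟨k - 1, hk⟩ : ℕ) else 0
    else 0

/-- The property `Φ` of automata is decidable in linear time on the minimal automata over `Fin b`:
for some program and some constant `C`, on every minimal automaton with `n` states the program,
with words bounded by `C * n` (that is, words of logarithmically many bits), halts within `C * n`
steps, with 1 in register 0 if the automaton has the property and with 0 there if not. -/
def LinearTimeOnMinimal (b : ℕ) (Φ : ∀ {n : ℕ}, DFA (Fin b) (Fin n) → Prop) : Prop :=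
  ∃ (P : Prog) (C : ℕ), ∀ (n : ℕ) (A : DFA (Fin b) (Fin n)), IsMinimal A →
    ∃ (t : ℕ) (s : State), Exec (C * n) P (input A) t s ∧ t ≤ C * n ∧
      (Φ A → s.reg 0 = 1) ∧ (¬ Φ A → s.reg 0 = 0)

end UPC

/-! Let z be the action of the digit 0. In a Pascal automaton the digit a acts as z ∘ g^a, where
g(s, t) = (s + b^t, t), and g ∘ z = z ∘ g^b. The proof characterises the UP-criterion by the
existence of such a g on the core, that is, on the states reachable from a cycle.

`LocalCriterion` says this without mentioning components. Injectivity of z on the finite core makes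
z a permutation of it, so g q can be defined as the state r of the core with r·0 = q·1. The
condition `carry` then says that every digit a acts as z ∘ g^a and that g ∘ z = z ∘ g^b, and
`inj_one` makes g injective on its image g(core).

Necessity (`UPCriterion.localCriterion`): under the criterion the components met by the core are
non-trivial. The laws hold in quotients of Pascal automata, and a state of Type 2 agrees on non-zero
digits with a state of a leaf, by the embedding.

Sufficiency (`LocalCriterion.upCriterion`): all digits permute g(core), so its components are
leaves. If p is the period of i under g, then (s, t) ↦ z^t g^s i is the covering by a Pascal
automaton. Non-zero digits lead from the core into g(core), so every Type 1 component lies there and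
a Type 2 component is an orbit of z; it is embedded by sending q to the state of g(core) with the
same image under g. Minimality enters by turning equality of languages into equality of states.

The local conditions are tested in linear time: the core is found by deleting vertices of in-degree
0 with a queue, injectivity is tested by writing a table of preimages and reading it back, and what
remains is a bounded number of table lookups per state. -/

namespace UPC

/-! ### Strong components and the core -/

section Core

variable {α σ : Type*} {A : DFA α σ}

theorem Reach.refl (q : σ) : Reach A q q := ⟨[], rfl⟩

theorem Reach.trans {q r s : σ} : Reach A q r → Reach A r s → Reach A q s := by
  rintro ⟨u, rfl⟩ ⟨v, rfl⟩
  exact ⟨u ++ v, DFA.evalFrom_of_append ..⟩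

theorem Reach.step (q : σ) (a : α) : Reach A q (A.step q a) := ⟨[a], rfl⟩

theorem sccOf_eq_iff {q r : σ} : sccOf A q = sccOf A r ↔ Reach A q r ∧ Reach A r q :=
  Quotient.eq (r := strongConn A)

theorem mem_states {q : σ} {x : SCC A} : q ∈ states x ↔ sccOf A q = x := Iff.rfl

theorem mem_states_sccOf (q : σ) : q ∈ states (sccOf A q) := rfl

theorem reach_of_mem_states {x : SCC A} {q r : σ} (hq : q ∈ states x) (hr : r ∈ states x) :
    Reach A q r := (sccOf_eq_iff.1 (hq.trans hr.symm)).1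

theorem exists_mem_states (x : SCC A) : ∃ q, q ∈ states x := Quotient.exists_rep x

theorem mem_states_of_reach {x : SCC A} {q r : σ} (hq : q ∈ states x) (h : Reach A q r)
    (h' : Reach A r q) : r ∈ states x := (sccOf_eq_iff.2 ⟨h', h⟩).trans hq

/-- The largest set of states in which every state has a predecessor: what is left of the automaton
when the states without predecessors are deleted repeatedly. -/
def core (A : DFA α σ) : Set σ := {q | ∃ S : Set σ, q ∈ S ∧ ∀ r ∈ S, ∃ s ∈ S, ∃ a, A.step s a = r}

theorem subset_core {S : Set σ} (h : ∀ r ∈ S, ∃ s ∈ S, ∃ a, A.step s a = r) : S ⊆ core A :=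
  fun _ hq => ⟨S, hq, h⟩

theorem step_mem_core {q : σ} (hq : q ∈ core A) (a : α) : A.step q a ∈ core A := by
  obtain ⟨S, hS, h⟩ := hq
  refine ⟨insert (A.step q a) S, Set.mem_insert .., ?_⟩
  rintro r (rfl | hr)
  · exact ⟨q, Set.mem_insert_of_mem _ hS, a, rfl⟩
  · obtain ⟨s, hs, h⟩ := h r hr
    exact ⟨s, Set.mem_insert_of_mem _ hs, h⟩

theorem exists_pred_core {r : σ} (hr : r ∈ core A) : ∃ q ∈ core A, ∃ a, A.step q a = r := by
  obtain ⟨S, hS, h⟩ := hr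
  obtain ⟨s, hs, h'⟩ := h r hS
  exact ⟨s, ⟨S, hs, h⟩, h'⟩

/-- Predecessors inside the component come from the last edge of a path that starts at the end of an
internal transition, or from that transition itself if the path is empty. -/
theorem states_subset_core {x : SCC A} (hx : Nontriv x) : states x ⊆ core A := by
  obtain ⟨q, hq, a, ha⟩ := hx
  refine subset_core fun r hr => ?_
  obtain ⟨w, hw⟩ := reach_of_mem_states ha hr
  rcases List.eq_nil_or_concat w with rfl | ⟨v, c, rfl⟩
  · exact ⟨q, hq, a, hw⟩
  · refine ⟨A.evalFrom (A.step q a) v, mem_states_of_reach ha ⟨v, rfl⟩ ?_, c, ?_⟩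
    · refine (Reach.trans ⟨[c], ?_⟩ (reach_of_mem_states hr ha))
      simpa using hw
    · simpa using hw

/-- Every state of the core can be reached from a cycle. -/
theorem exists_nontriv_of_mem_core [Finite σ] {q : σ} (hq : q ∈ core A) :
    ∃ r, Nontriv (sccOf A r) ∧ Reach A r q := by
  choose! p hp hp' using fun r (hr : r ∈ core A) => exists_pred_core hr
  have hmem : ∀ k, p^[k] q ∈ core A := by
    intro k
    induction k with
    | zero => exact hq
    | succ k ih => rw [Function.iterate_succ_apply']; exact hp _ ih
  have hreach : ∀ k m, Reach A (p^[k + m] q) (p^[k] q) := by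
    intro k m
    induction m with
    | zero => exact Reach.refl _
    | succ m ih =>
      refine Reach.trans ?_ ih
      obtain ⟨a, ha⟩ := hp' _ (hmem (k + m))
      refine ⟨[a], ?_⟩
      rw [← Nat.add_assoc, Function.iterate_succ_apply']
      exact ha
  -- Going backwards from q within a finite set, some state repeats, which closes a cycle from which
  -- q is reachable.
  obtain ⟨i, j, hij, h⟩ : ∃ i j, i < j ∧ p^[i] q = p^[j] q := by
    obtain ⟨i, j, hij, h⟩ := Finite.exists_ne_map_eq_of_infinite (fun k : ℕ => p^[k] q)
    rcases hij.lt_or_gt with hl | hl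
    · exact ⟨i, j, hl, h⟩
    · exact ⟨j, i, hl, h.symm⟩
  refine ⟨p^[j] q, ?_, by simpa using hreach 0 j⟩
  obtain ⟨a, ha⟩ := hp' _ (hmem i)
  rw [← Function.iterate_succ_apply' (f := p)] at ha
  have h1 : Reach A (p^[j] q) (p^[i + 1] q) := by
    obtain ⟨m, rfl⟩ := Nat.exists_eq_add_of_lt hij
    have := hreach (i + 1) m
    rwa [show i + 1 + m = i + m + 1 by omega] at this
  have hm : p^[i + 1] q ∈ states (sccOf A (p^[j] q)) :=
    mem_states_of_reach (mem_states_sccOf _) h1 ⟨[a], by simpa [h] using ha⟩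
  exact ⟨_, hm, a, by rw [ha, h]; exact mem_states_sccOf _⟩

theorem step_mem_states_of_isLeaf {x : SCC A} (hx : IsLeaf x) {q : σ} (hq : q ∈ states x) (a : α) :
    A.step q a ∈ states x := by
  by_contra h
  exact hx (sccOf A (A.step q a)) ⟨⟨q, hq, a, mem_states_sccOf _⟩, h⟩

end Core

/-! ### The criterion in terms of single states -/

section Digits

variable {b : ℕ} {σ : Type*} {A : DFA (Fin b) σ}

/-- The successor of a state by a digit, given as a natural number. -/
def nx (A : DFA (Fin b) σ) (a : ℕ) (q : σ) : σ := if h : a < b then A.step q ⟨a, h⟩ else q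

theorem step_eq_nx (q : σ) (a : Fin b) : A.step q a = nx A a q := by simp [nx]

theorem nx_eq_step {a : ℕ} (h : a < b) (q : σ) : nx A a q = A.step q ⟨a, h⟩ := by simp [nx, h]

theorem nx_mem_core {a : ℕ} {q : σ} (hq : q ∈ core A) : nx A a q ∈ core A := by
  unfold nx
  split_ifs
  · exact step_mem_core hq _
  · exact hq

/-- A reformulation of the UP-criterion by conditions on single states. -/
structure LocalCriterion (A : DFA (Fin b) σ) : Prop where
  final : ∀ q, nx A 0 q ∈ A.accept ↔ q ∈ A.accept
  inj_zero : Set.InjOn (nx A 0) (core A)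
  inj_one : ∀ q ∈ core A, ∀ r ∈ core A, nx A 1 (nx A 1 q) = nx A 1 (nx A 1 r) →
    nx A 1 q = nx A 1 r
  carry : ∀ q ∈ core A, ∀ r ∈ core A, nx A 0 r = nx A 1 q →
    (∀ a, a + 1 < b → nx A (a + 1) q = nx A a r) ∧ nx A 0 (nx A (b - 1) r) = nx A 1 (nx A 0 q)

end Digits

/-! ### The UP-criterion implies the local criterion -/

section Necessity

variable {b : ℕ} {σ : Type*} {A : DFA (Fin b) σ}

/-- A leaf is closed under all digits, and the digit 1 exists because b ≥ 2. -/
theorem isType1_of_isLeaf (hb : 2 ≤ b) {x : SCC A} (hx : IsLeaf x) : IsType1 x := by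
  obtain ⟨q, hq⟩ := exists_mem_states x
  exact ⟨q, hq, ⟨1, hb⟩, one_ne_zero, step_mem_states_of_isLeaf hx hq _⟩

theorem IsType1.nontriv {x : SCC A} (hx : IsType1 x) : Nontriv x :=
  let ⟨q, hq, a, _, h⟩ := hx; ⟨q, hq, a, h⟩

theorem psi_pos {p : ℕ} (hp : 0 < p) (h : p.Coprime b) : 0 < psi b p := by
  have : NeZero p := ⟨hp.ne'⟩
  have : IsUnit (b : ZMod p) := (ZMod.isUnit_iff_coprime b p).2 h.symm
  obtain ⟨u, hu⟩ := this
  rw [psi, ← hu, orderOf_units]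
  exact orderOf_pos u

theorem pow_psi_mod (p m : ℕ) : (b : ZMod p) ^ (m % psi b p) = (b : ZMod p) ^ m :=
  pow_mod_orderOf _ _

theorem pow_val_add_one {p : ℕ} (hp : 0 < psi b p) (t : ZMod (psi b p)) :
    (b : ZMod p) ^ (t + 1).val = (b : ZMod p) ^ t.val * b := by
  have : NeZero (psi b p) := ⟨hp.ne'⟩
  rw [ZMod.val_add, pow_psi_mod, pow_add, ZMod.val_one_eq_one_mod, pow_psi_mod]
  rw [pow_one]

theorem IsPascalParam.psi_pos {p : ℕ} {R : Set (ZMod p)} (h : IsPascalParam b p R) :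
    0 < psi b p := UPC.psi_pos h.2.1.1 h.1

/-- Each digit permutes the states of a Pascal automaton, and an explicit preimage is carried over
by the covering. -/
theorem surjOn_of_isQuotientOf {x : SCC A} {p : ℕ} {R : Set (ZMod p)}
    (hQ : IsQuotientOf x (pascal b p R)) (a : Fin b) :
    Set.SurjOn (A.step · a) (states x) (states x) := by
  obtain ⟨φ, hφ, hstep, -⟩ := hQ
  intro r hr
  rw [← hφ] at hr
  obtain ⟨⟨s, t⟩, rfl⟩ := hr
  refine ⟨φ (s - ((a : ℕ) : ZMod p) * (b : ZMod p) ^ (t - 1).val, t - 1), hφ ▸ ⟨_, rfl⟩, ?_⟩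
  simp only [← hstep]
  simp [pascal]

theorem injOn_of_isQuotientOf [Finite σ] {x : SCC A} (hx : IsLeaf x) {p : ℕ} {R : Set (ZMod p)}
    (hQ : IsQuotientOf x (pascal b p R)) (a : Fin b) : Set.InjOn (A.step · a) (states x) := by
  have hm : Set.MapsTo (A.step · a) (states x) (states x) :=
    fun q hq => step_mem_states_of_isLeaf hx hq a
  have hs := surjOn_of_isQuotientOf hQ a
  rw [← hm.restrict_surjective_iff] at hs
  rw [← hm.restrict_inj]
  exact Finite.injective_iff_surjective.2 hs

/-- If q is the image of (s, t), then injectivity of 0 forces r to be the image of (s + b^t, t). The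
two claims become identities in ℤ/pℤ, the second one being the carry b^t + (b - 1) b^t = b^(t+1). -/
theorem carry_of_isQuotientOf [Finite σ] (hb : 2 ≤ b) {x : SCC A} (hx : IsLeaf x) {p : ℕ}
    {R : Set (ZMod p)} (hP : IsPascalParam b p R) (hQ : IsQuotientOf x (pascal b p R)) {q r : σ}
    (hq : q ∈ states x) (hr : r ∈ states x) (h : nx A 0 r = nx A 1 q) :
    (∀ a, a + 1 < b → nx A (a + 1) q = nx A a r) ∧
      nx A 0 (nx A (b - 1) r) = nx A 1 (nx A 0 q) := by
  have hinj := injOn_of_isQuotientOf hx hQ ⟨0, by omega⟩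
  obtain ⟨φ, hφ, hstep, -⟩ := hQ
  rw [← hφ] at hq
  obtain ⟨⟨s, t⟩, rfl⟩ := hq
  have hn : ∀ a < b, ∀ s t, nx A a (φ (s, t)) = φ (s + a * (b : ZMod p) ^ t.val, t + 1) := by
    intro a ha s t
    rw [nx_eq_step ha, ← hstep]
    rfl
  have hr' : r = φ (s + (b : ZMod p) ^ t.val, t) := by
    refine hinj hr (hφ ▸ ⟨_, rfl⟩) ?_
    simp only [← nx_eq_step (A := A) (show 0 < b by omega)]
    rw [h, hn 1 (by omega), hn 0 (by omega)]
    simp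
  subst hr'
  refine ⟨fun a ha => ?_, ?_⟩
  · rw [hn _ ha, hn _ (by omega)]
    congr 2
    push_cast
    ring
  · rw [hn _ (by omega), hn 0 (by omega), hn 0 (by omega), hn 1 (by omega)]
    congr 2
    rw [pow_val_add_one hP.psi_pos, Nat.cast_sub (by omega)]
    push_cast
    ring

theorem Nontriv.isType1_or {x : SCC A} (h : Nontriv x) : IsType1 x ∨ IsType2 x := by
  by_cases h' : IsType1 x
  · exact .inl h'
  · exact .inr ⟨h, h'⟩

/-- Only a Type 2 component can be left, and then for a leaf, which is non-trivial. -/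
theorem UPCriterion.nontriv_step (hA : UPCriterion A) (hb : 2 ≤ b) {q : σ}
    (hq : Nontriv (sccOf A q)) (a : Fin b) : Nontriv (sccOf A (A.step q a)) := by
  by_cases hs : A.step q a ∈ states (sccOf A q)
  · rwa [mem_states.1 hs]
  rcases Nontriv.isType1_or hq with h1 | h2
  · exact absurd (step_mem_states_of_isLeaf (hA.up1 _ h1) (mem_states_sccOf q) a) hs
  · obtain ⟨y, -, hu, hy⟩ := hA.up2_succ _ h2
    rw [hu (sccOf A (A.step q a)) ⟨⟨q, mem_states_sccOf q, a, mem_states_sccOf _⟩, hs⟩]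
    exact (isType1_of_isLeaf hb hy).nontriv

theorem UPCriterion.nontriv_of_mem_core [Finite σ] (hA : UPCriterion A) (hb : 2 ≤ b) {q : σ}
    (hq : q ∈ core A) : Nontriv (sccOf A q) := by
  obtain ⟨r, hr, w, rfl⟩ := exists_nontriv_of_mem_core hq
  induction w using List.reverseRecOn with
  | nil => exact hr
  | append_singleton w a ih =>
    rw [DFA.evalFrom_append_singleton]
    by_cases hc : A.evalFrom r w ∈ core A
    · exact hA.nontriv_step hb (ih hc) a
    · have : ∀ w, A.evalFrom r w ∈ core A := by
        intro w
        induction w using List.reverseRecOn with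
        | nil => exact states_subset_core hr (mem_states_sccOf r)
        | append_singleton w a ih =>
          rw [DFA.evalFrom_append_singleton]
          exact step_mem_core ih a
      exact absurd (this w) hc

theorem UPCriterion.zero_mem_states (hA : UPCriterion A) (hb : 2 ≤ b) {x : SCC A} (hx : Nontriv x)
    {q : σ} (hq : q ∈ states x) : nx A 0 q ∈ states x := by
  rw [nx_eq_step (show 0 < b by omega)]
  rcases Nontriv.isType1_or hx with h1 | h2
  · exact step_mem_states_of_isLeaf (hA.up1 _ h1) hq _
  · obtain ⟨l, -, c, -, hc, hs⟩ := hA.up2_circuit _ h2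
    rw [← hc] at hq ⊢
    obtain ⟨i, rfl⟩ := hq
    exact ⟨i + 1, ((hs i _).1 rfl).symm⟩

/-- The digit 0 does not leave a non-trivial component, so states with equal 0-successors share a
component, on which 0 is injective by the Pascal quotient or by the circuit. -/
theorem UPCriterion.inj_zero [Finite σ] (hA : UPCriterion A) (hb : 2 ≤ b) :
    Set.InjOn (nx A 0) (core A) := by
  intro q hq r hr h
  have hq' := hA.nontriv_of_mem_core hb hq
  have hr' := hA.nontriv_of_mem_core hb hr
  have e : sccOf A q = sccOf A r := by
    rw [← hA.zero_mem_states hb hq' rfl, ← hA.zero_mem_states hb hr' rfl, h]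
  simp only [nx_eq_step (A := A) (show 0 < b by omega)] at h
  rcases Nontriv.isType1_or hq' with h1 | h2
  · obtain ⟨p, R, -, hQ⟩ := hA.up3 _ h1
    exact injOn_of_isQuotientOf (hA.up1 _ h1) hQ _ rfl e.symm h
  · obtain ⟨l, -, c, hc, hs', hs⟩ := hA.up2_circuit _ h2
    have hi : q ∈ Set.range c := hs' ▸ mem_states_sccOf q
    have hj : r ∈ Set.range c := hs' ▸ e.symm
    obtain ⟨i, rfl⟩ := hi
    obtain ⟨j, rfl⟩ := hj
    rw [(hs i _).1 rfl, (hs j _).1 rfl] at h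
    rw [add_right_cancel (hc h)]

/-- Every state of the core behaves as a state of a Type 1 component as far as the transitions by
non-zero digits are concerned. -/
theorem UPCriterion.exists_shadow [Finite σ] (hA : UPCriterion A) (hb : 2 ≤ b) {q : σ}
    (hq : q ∈ core A) : ∃ y : SCC A, IsType1 y ∧ ∃ r ∈ states y,
      (∀ a, a ≠ 0 → a < b → nx A a q = nx A a r) ∧ nx A 1 (nx A 0 q) = nx A 1 (nx A 0 r) := by
  have hn := hA.nontriv_of_mem_core hb hq
  rcases Nontriv.isType1_or hn with h1 | h2
  · exact ⟨_, h1, q, rfl, fun _ _ _ => rfl, rfl⟩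
  obtain ⟨y, hy, -, hl⟩ := hA.up2_succ _ h2
  have hq0 := hA.zero_mem_states hb hn rfl
  obtain ⟨f, -, hf⟩ := hA.up4 _ y h2 hy
  have hout : ∀ r ∈ states (sccOf A q), ∀ a : Fin b, (a : ℕ) ≠ 0 →
      A.step r a ∉ states (sccOf A q) := by
    intro r hr a ha hs
    exact h2.2 ⟨r, hr, a, ha, hs⟩
  have hne : ∀ (r : states (sccOf A q)) (a : ℕ), a ≠ 0 → a < b → nx A a r = nx A a (f r) := by
    intro r a ha ha'
    rw [nx_eq_step ha', nx_eq_step ha', (hf r ⟨a, ha'⟩).2 (hout r r.2 _ ha)]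
  refine ⟨y, isType1_of_isLeaf hb hl, f ⟨q, rfl⟩, (f ⟨q, rfl⟩).2, hne ⟨q, rfl⟩, ?_⟩
  rw [hne ⟨nx A 0 q, hq0⟩ 1 one_ne_zero hb]
  congr 1
  have h0 : (0 : ℕ) < b := by omega
  have hq0' := hq0
  rw [nx_eq_step h0] at hq0'
  have e : (⟨nx A 0 q, hq0⟩ : states (sccOf A q)) = ⟨_, hq0'⟩ := Subtype.ext (nx_eq_step h0 q)
  rw [e, (hf ⟨q, rfl⟩ ⟨0, h0⟩).1 hq0', nx_eq_step h0]

theorem UPCriterion.localCriterion [Finite σ] (hA : UPCriterion A) (hb : 2 ≤ b) :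
    LocalCriterion A where
  final q := by
    rw [nx_eq_step (show 0 < b by omega)]
    exact hA.up0 q _ rfl
  inj_zero := hA.inj_zero hb
  inj_one q hq r hr h := by
    obtain ⟨y, hy, s, hs, h1, -⟩ := hA.exists_shadow hb hq
    obtain ⟨y', hy', s', hs', h1', -⟩ := hA.exists_shadow hb hr
    rw [h1 1 one_ne_zero hb, h1' 1 one_ne_zero hb] at h ⊢
    simp only [nx_eq_step (A := A) (show 1 < b by omega)] at h ⊢
    have e1 := step_mem_states_of_isLeaf (hA.up1 _ hy) hs ⟨1, hb⟩
    have e2 := step_mem_states_of_isLeaf (hA.up1 _ hy') hs' ⟨1, hb⟩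
    have e3 := step_mem_states_of_isLeaf (hA.up1 _ hy) e1 ⟨1, hb⟩
    have e4 := step_mem_states_of_isLeaf (hA.up1 _ hy') e2 ⟨1, hb⟩
    -- The common state after 11 puts both shadows into the same leaf, where the digit 1 is
    -- injective.
    rw [h] at e3
    obtain rfl : y = y' := e3.symm.trans e4
    obtain ⟨p, R, -, hQ⟩ := hA.up3 _ hy
    exact injOn_of_isQuotientOf (hA.up1 _ hy) hQ _ e1 e2 h
  carry q hq r hr h := by
    obtain ⟨y, hy, s, hs, h1, h2⟩ := hA.exists_shadow hb hq
    have hl := hA.up1 _ hy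
    -- The state r·0 lies in the leaf of the shadow, and 0 does not leave the component of r.
    have hr' : r ∈ states y := by
      have e := hA.zero_mem_states hb (hA.nontriv_of_mem_core hb hr) rfl
      rw [h, h1 1 one_ne_zero hb, nx_eq_step (show 1 < b by omega)] at e
      exact e.symm.trans (step_mem_states_of_isLeaf hl hs _)
    rw [h1 1 one_ne_zero hb] at h
    obtain ⟨p, R, hP, hQ⟩ := hA.up3 _ hy
    have := carry_of_isQuotientOf hb hl hP hQ hs hr' h
    exact ⟨fun a ha => (h1 _ (Nat.succ_ne_zero a) ha).trans (this.1 a ha), this.2.trans h2.symm⟩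

end Necessity

/-! ### Injective self-maps of finite sets -/

section FiniteMaps

variable {σ : Type*} [Finite σ] {f : σ → σ} {T : Set σ}

theorem exists_iterate_eq_of_injOn (hm : Set.MapsTo f T T) (hi : Set.InjOn f T) {q : σ}
    (hq : q ∈ T) : ∃ k, f^[k + 1] q = q := by
  have h := ((hm.restrict_inj).2 hi).mem_periodicPts ⟨q, hq⟩
  obtain ⟨k, hk, h⟩ := Function.mem_periodicPts.1 h
  refine ⟨k - 1, ?_⟩
  rw [Nat.sub_add_cancel hk]
  have h' := congrArg Subtype.val h
  rw [hm.iterate_restrict] at h'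
  exact h'

theorem surjOn_of_injOn (hm : Set.MapsTo f T T) (hi : Set.InjOn f T) : Set.SurjOn f T T := by
  intro q hq
  obtain ⟨k, hk⟩ := exists_iterate_eq_of_injOn hm hi hq
  exact ⟨f^[k] q, hm.iterate k hq, by rw [← Function.iterate_succ_apply' f, hk]⟩

end FiniteMaps

/-! ### Digits acting through two maps z and g -/

variable {b : ℕ} {σ : Type*} {A : DFA (Fin b) σ}

/-- On the set `Z`, the digit `a` acts as `z ∘ g ^ a`, where `z` is injective and `g ∘ z = z ∘ g ^ b`. -/
structure DigitAction (A : DFA (Fin b) σ) (z g : σ → σ) (Z : Set σ) : Prop where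
  mapsTo_z : Set.MapsTo z Z Z
  mapsTo_g : Set.MapsTo g Z Z
  injOn_z : Set.InjOn z Z
  step : ∀ q ∈ Z, ∀ a : Fin b, A.step q a = z (g^[a] q)
  rel : ∀ q ∈ Z, g (z q) = z (g^[b] q)

namespace DigitAction

variable {z g : σ → σ} {Z : Set σ}

theorem iterate_g_z (D : DigitAction A z g Z) {q : σ} (hq : q ∈ Z) (k : ℕ) :
    g^[k] (z q) = z (g^[k * b] q) := by
  induction k with
  | zero => simp
  | succ k ih =>
    rw [Function.iterate_succ_apply', ih, D.rel _ (D.mapsTo_g.iterate _ hq),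
      ← Function.iterate_add_apply]
    congr 2
    ring

/-- Each exchange of g with a factor z multiplies the exponent of g by b. -/
theorem iterate_g_iterate_z (D : DigitAction A z g Z) {q : σ} (hq : q ∈ Z) (t : ℕ) :
    ∀ k, g^[k] (z^[t] q) = z^[t] (g^[k * b ^ t] q) := by
  induction t with
  | zero => simp
  | succ t ih =>
    intro k
    rw [Function.iterate_succ_apply', D.iterate_g_z (D.mapsTo_z.iterate _ hq), ih,
      Function.iterate_succ_apply']
    congr 3
    ring

theorem mem_iterate (D : DigitAction A z g Z) {q : σ} (hq : q ∈ Z) (t s : ℕ) :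
    z^[t] (g^[s] q) ∈ Z := D.mapsTo_z.iterate _ (D.mapsTo_g.iterate _ hq)

/-- On exponents this is the Pascal transition (s, t) ↦ (s + a b^t, t + 1). -/
theorem step_iterate (D : DigitAction A z g Z) {q : σ} (hq : q ∈ Z) (t s : ℕ) (a : Fin b) :
    A.step (z^[t] (g^[s] q)) a = z^[t + 1] (g^[a * b ^ t + s] q) := by
  rw [D.step _ (D.mem_iterate hq t s), D.iterate_g_iterate_z (D.mapsTo_g.iterate _ hq),
    ← Function.iterate_add_apply, Function.iterate_succ_apply']

/-- A word acts as `z ^ t ∘ g ^ s` for some `t` and `s` that do not depend on the state. -/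
theorem exists_evalFrom (D : DigitAction A z g Z) (w : List (Fin b)) :
    ∃ t s, ∀ q ∈ Z, A.evalFrom q w = z^[t] (g^[s] q) := by
  induction w using List.reverseRecOn with
  | nil => exact ⟨0, 0, fun _ _ => rfl⟩
  | append_singleton w a ih =>
    obtain ⟨t, s, h⟩ := ih
    refine ⟨t + 1, a * b ^ t + s, fun q hq => ?_⟩
    rw [DFA.evalFrom_append_singleton, h q hq, D.step_iterate hq]

theorem mem_of_reach (D : DigitAction A z g Z) {q r : σ} (hq : q ∈ Z) (h : Reach A q r) :
    r ∈ Z := by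
  obtain ⟨w, rfl⟩ := h
  obtain ⟨t, s, h⟩ := D.exists_evalFrom w
  rw [h q hq]
  exact D.mem_iterate hq t s

theorem reach_z (D : DigitAction A z g Z) (hb : 0 < b) {q : σ} (hq : q ∈ Z) (t : ℕ) :
    Reach A q (z^[t] q) := by
  induction t with
  | zero => exact Reach.refl q
  | succ t ih =>
    refine ih.trans ⟨[⟨0, hb⟩], ?_⟩
    rw [DFA.evalFrom_singleton, D.step _ (D.mapsTo_z.iterate _ hq), Function.iterate_succ_apply']
    rfl

theorem injOn_step (D : DigitAction A z g Z) (hg : Set.InjOn g Z) (a : Fin b) :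
    Set.InjOn (A.step · a) Z := by
  intro q hq r hr h
  simp only [D.step q hq, D.step r hr] at h
  exact hg.iterate D.mapsTo_g a hq hr
    (D.injOn_z (D.mapsTo_g.iterate _ hq) (D.mapsTo_g.iterate _ hr) h)

theorem iterate_eq_of_cast_eq {i : σ} {s s' : ℕ} (h : (s : ZMod (g.minimalPeriod i)) = s') :
    g^[s] i = g^[s'] i := by
  rw [ZMod.natCast_eq_natCast_iff'] at h
  rw [← Function.iterate_mod_minimalPeriod_eq, h, Function.iterate_mod_minimalPeriod_eq]

theorem iterate_z_mem_accept (hfin : ∀ q, z q ∈ A.accept ↔ q ∈ A.accept) (t : ℕ) (q : σ) :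
    z^[t] q ∈ A.accept ↔ q ∈ A.accept := by
  induction t with
  | zero => rfl
  | succ t ih => rw [Function.iterate_succ_apply', hfin, ih]

/-- Both states accept the same words: z does not affect finality, and moving g^s' past z^ψ
multiplies s' by b^ψ, which is 1 modulo the period of i. -/
theorem iterate_psi {i : σ} (D : DigitAction A z g Z) (hfin : ∀ q, z q ∈ A.accept ↔ q ∈ A.accept)
    (hinj : Function.Injective A.acceptsFrom) (hi : i ∈ Z) (s : ℕ) :
    z^[psi b (g.minimalPeriod i)] (g^[s] i) = g^[s] i := by
  apply hinj
  ext w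
  have hs := D.mapsTo_g.iterate s hi
  obtain ⟨t', s', h⟩ := D.exists_evalFrom w
  rw [DFA.mem_acceptsFrom, DFA.mem_acceptsFrom, h _ (D.mapsTo_z.iterate _ hs), h _ hs,
    iterate_z_mem_accept hfin, iterate_z_mem_accept hfin, D.iterate_g_iterate_z hs,
    iterate_z_mem_accept hfin, ← Function.iterate_add_apply, ← Function.iterate_add_apply]
  rw [iterate_eq_of_cast_eq (i := i) (g := g) (s' := s' + s)]
  push_cast
  rw [psi, pow_orderOf_eq_one, mul_one]

variable [Finite σ]

/-- The digit 1 acts as z ∘ g, and further zeros undo z because z is a permutation of the finite set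
Z. -/
theorem reach_g (D : DigitAction A z g Z) (hb : 2 ≤ b) {q : σ} (hq : q ∈ Z) (s : ℕ) :
    Reach A q (g^[s] q) := by
  induction s with
  | zero => exact Reach.refl q
  | succ s ih =>
    have hs := D.mapsTo_g.iterate s hq
    have hs' := D.mapsTo_g.iterate (s + 1) hq
    obtain ⟨k, hk⟩ := exists_iterate_eq_of_injOn D.mapsTo_z D.injOn_z hs'
    have h1 : Reach A (g^[s] q) (z (g^[s + 1] q)) := by
      refine ⟨[⟨1, hb⟩], ?_⟩
      rw [DFA.evalFrom_singleton, D.step _ hs, ← Function.iterate_add_apply, Nat.add_comm]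
    have h2 := D.reach_z (by omega) (D.mapsTo_z hs') k
    rw [← Function.iterate_succ_apply, hk] at h2
    exact (ih.trans h1).trans h2

/-- Invariance under z is the point: g permutes g(Z), so each of its elements is g^b r with r in
g(Z), and z (g^b r) = g (z r). -/
theorem restrict_image (D : DigitAction A z g Z) (hg : Set.InjOn g (g '' Z)) :
    DigitAction A z g (g '' Z) := by
  have hsub : g '' Z ⊆ Z := D.mapsTo_g.image_subset
  have hm : Set.MapsTo g (g '' Z) (g '' Z) := fun q hq => ⟨q, hsub hq, rfl⟩
  have hs := (surjOn_of_injOn hm hg).iterate b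
  refine ⟨fun q hq => ?_, hm, D.injOn_z.mono hsub, fun q hq => D.step q (hsub hq),
    fun q hq => D.rel q (hsub hq)⟩
  obtain ⟨r, hr, rfl⟩ := hs hq
  exact ⟨z r, D.mapsTo_z (hsub hr), D.rel r (hsub hr)⟩

/-- Each digit permutes Z, so repeating it leads back. -/
theorem reach_symm (D : DigitAction A z g Z) (hg : Set.InjOn g Z) {q r : σ} (hq : q ∈ Z)
    (h : Reach A q r) : Reach A r q := by
  obtain ⟨w, rfl⟩ := h
  induction w generalizing q with
  | nil => exact Reach.refl q
  | cons a w ih =>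
    have hm : Set.MapsTo (A.step · a) Z Z := fun q hq => D.mem_of_reach hq (Reach.step q a)
    refine (ih (hm hq)).trans ?_
    obtain ⟨k, hk⟩ := exists_iterate_eq_of_injOn hm (D.injOn_step hg a) hq
    rw [Function.iterate_succ_apply] at hk
    have : ∀ k r, Reach A r ((A.step · a)^[k] r) := by
      intro k r
      induction k with
      | zero => exact Reach.refl r
      | succ k ih => rw [Function.iterate_succ_apply']; exact ih.trans (Reach.step _ a)
    have h := this k (A.step q a)
    rwa [hk] at h

theorem mem_states_iff (D : DigitAction A z g Z) (hg : Set.InjOn g Z) {q r : σ} (hq : q ∈ Z) :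
    r ∈ states (sccOf A q) ↔ Reach A q r :=
  ⟨fun h => reach_of_mem_states (mem_states_sccOf q) h,
    fun h => mem_states_of_reach (mem_states_sccOf q) h (D.reach_symm hg hq h)⟩

theorem isLeaf (D : DigitAction A z g Z) (hg : Set.InjOn g Z) {q : σ} (hq : q ∈ Z) :
    IsLeaf (sccOf A q) := by
  rintro y ⟨⟨r, hr, a, ha⟩, hne⟩
  have hr' := (D.mem_states_iff hg hq).1 hr
  exact hne (ha.symm.trans ((D.mem_states_iff hg hq).2 (hr'.trans (Reach.step r a))))

theorem isType1 (D : DigitAction A z g Z) (hb : 2 ≤ b) (hg : Set.InjOn g Z) {q : σ}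
    (hq : q ∈ Z) : IsType1 (sccOf A q) := isType1_of_isLeaf hb (D.isLeaf hg hq)

/-! ### The Pascal automaton covering a component -/

section Pascal

variable {i : σ}

theorem minimalPeriod_pos (D : DigitAction A z g Z) (hg : Set.InjOn g Z) (hi : i ∈ Z) :
    0 < g.minimalPeriod i := by
  obtain ⟨k, hk⟩ := exists_iterate_eq_of_injOn D.mapsTo_g hg hi
  exact Function.IsPeriodicPt.minimalPeriod_pos (Nat.succ_pos k) hk

/-- Let d = p / gcd(p, b). Since i = z^(k+1) i for some k, moving g^d past z^(k+1) gives the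
exponent d b^(k+1), a multiple of p; so g^d fixes i, p divides d, and the gcd is 1. -/
theorem coprime_minimalPeriod (D : DigitAction A z g Z) (hg : Set.InjOn g Z) (hi : i ∈ Z) :
    (g.minimalPeriod i).Coprime b := by
  set p := g.minimalPeriod i with hp
  obtain ⟨k, hk⟩ := exists_iterate_eq_of_injOn D.mapsTo_z D.injOn_z hi
  have hpos := D.minimalPeriod_pos hg hi
  obtain ⟨d, hd⟩ := Nat.gcd_dvd_left p b
  obtain ⟨c, hc⟩ := Nat.gcd_dvd_right p b
  have h : g^[d] i = i := by
    have h1 := D.iterate_g_iterate_z hi (k + 1) d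
    rw [hk] at h1
    rw [h1]
    have : g^[d * b ^ (k + 1)] i = g^[0] i := by
      refine iterate_eq_of_cast_eq ?_
      rw [Nat.cast_zero, ZMod.natCast_eq_zero_iff, ← hp]
      refine ⟨c * b ^ k, ?_⟩
      calc d * b ^ (k + 1) = d * (p.gcd b * c) * b ^ k := by rw [← hc]; ring
        _ = p.gcd b * d * (c * b ^ k) := by ring
        _ = p * (c * b ^ k) := by rw [← hd]
    rw [this]
    exact hk
  have hle : p ∣ d := Function.IsPeriodicPt.minimalPeriod_dvd h
  have hd0 : 0 < d := Nat.pos_of_ne_zero (by rintro rfl; omega)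
  have := Nat.le_of_dvd hd0 hle
  rw [Nat.coprime_iff_gcd_eq_one]
  have h0 : 0 < p.gcd b := Nat.gcd_pos_of_pos_left _ hpos
  nlinarith

theorem exists_pascal (D : DigitAction A z g Z) (hb : 2 ≤ b) (hg : Set.InjOn g Z)
    (hfin : ∀ q, z q ∈ A.accept ↔ q ∈ A.accept) (hinj : Function.Injective A.acceptsFrom)
    (hi : i ∈ Z) : ∃ (p : ℕ) (R : Set (ZMod p)), IsPascalParam b p R ∧
      IsQuotientOf (sccOf A i) (pascal b p R) := by
  have hpos := D.minimalPeriod_pos hg hi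
  have hcop := D.coprime_minimalPeriod hg hi
  have hψ := D.iterate_psi hfin hinj hi
  have hψ0 := psi_pos hpos hcop
  have : NeZero (g.minimalPeriod i) := ⟨hpos.ne'⟩
  have : NeZero (psi b (g.minimalPeriod i)) := ⟨hψ0.ne'⟩
  have hmodz : ∀ t s, z^[t % psi b (g.minimalPeriod i)] (g^[s] i) = z^[t] (g^[s] i) :=
    fun t s => Function.IsPeriodicPt.iterate_mod_apply (hψ s) t
  have hres : ∀ m, m ∈ residueSet (g.minimalPeriod i) {s | g^[s.val] i ∈ A.accept} ↔
      g^[m] i ∈ A.accept := by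
    intro m
    change g^[(m : ZMod (g.minimalPeriod i)).val] i ∈ A.accept ↔ _
    rw [iterate_eq_of_cast_eq (ZMod.natCast_zmod_val _)]
  refine ⟨g.minimalPeriod i, {s | g^[s.val] i ∈ A.accept}, ⟨hcop, ⟨hpos, _, rfl⟩, ?_⟩,
    fun x => z^[x.2.val] (g^[x.1.val] i), ?_, ?_, ?_⟩
  -- If q is a period of the accepted residues, then g^q i and i accept the same words, hence
  -- coincide, and the minimal period p is at most q.
  · rintro q ⟨hq, S, hS⟩
    refine Function.IsPeriodicPt.minimalPeriod_le hq (hinj ?_)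
    ext w
    obtain ⟨t', s', h⟩ := D.exists_evalFrom w
    rw [DFA.mem_acceptsFrom, DFA.mem_acceptsFrom, h _ (D.mapsTo_g.iterate _ hi), h _ hi,
      iterate_z_mem_accept hfin, iterate_z_mem_accept hfin, ← Function.iterate_add_apply,
      ← hres, ← hres, hS]
    simp [residueSet]
  · ext r
    rw [D.mem_states_iff hg hi]
    constructor
    · rintro ⟨x, rfl⟩
      exact (D.reach_g hb hi _).trans (D.reach_z (by omega) (D.mapsTo_g.iterate _ hi) _)
    · rintro ⟨w, rfl⟩
      obtain ⟨t, s, h⟩ := D.exists_evalFrom w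
      refine ⟨(s, t), ?_⟩
      simp only [ZMod.val_natCast]
      rw [hmodz, Function.iterate_mod_minimalPeriod_eq, h i hi]
  · rintro ⟨s, t⟩ a
    simp only [pascal]
    rw [D.step_iterate hi, ZMod.val_add, hmodz, ZMod.val_one_eq_one_mod]
    -- The value of 1 in ℤ/ψℤ is 1 % ψ, which is 0 when ψ = 1.
    have e : ∀ s, z^[t.val + 1 % psi b (g.minimalPeriod i)] (g^[s] i) = z^[t.val + 1] (g^[s] i) := by
      intro s
      rw [← hmodz, Nat.add_mod_mod, hmodz]
    rw [e]
    congr 1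
    refine iterate_eq_of_cast_eq ?_
    simp [add_comm]
  · rintro ⟨s, t⟩
    exact iterate_z_mem_accept hfin _ _

end Pascal

end DigitAction

/-! ### The local criterion implies the UP-criterion -/

namespace LocalCriterion

variable [Finite σ]

theorem exists_digitAction (h : LocalCriterion A) (hb : 2 ≤ b) :
    ∃ g, DigitAction A (nx A 0) g (core A) ∧ Set.InjOn g (g '' core A) := by
  have hm : Set.MapsTo (nx A 0) (core A) (core A) := fun q hq => nx_mem_core hq
  have hs : ∀ q, q ∈ core A → ∃ r ∈ core A, nx A 0 r = q := surjOn_of_injOn hm h.inj_zero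
  choose! pre hpre hpre' using hs
  -- g q is the state of the core whose 0-successor is q·1, as z ∘ g is to be the action of 1.
  let g := fun q => pre (nx A 1 q)
  have hg : ∀ q ∈ core A, g q ∈ core A := fun q hq => hpre _ (nx_mem_core hq)
  have hzg : ∀ q ∈ core A, nx A 0 (g q) = nx A 1 q := fun q hq => hpre' _ (nx_mem_core hq)
  have hstep : ∀ a < b, ∀ q ∈ core A, nx A a q = nx A 0 (g^[a] q) := by
    intro a
    induction a with
    | zero => intro _ q _; rfl
    | succ a ih =>
      intro ha q hq
      rw [(h.carry q hq (g q) (hg q hq) (hzg q hq)).1 a ha, ih (by omega) _ (hg q hq),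
        Function.iterate_succ_apply]
  have hD : DigitAction A (nx A 0) g (core A) := by
    refine ⟨hm, hg, h.inj_zero, fun q hq a => ?_, fun q hq => ?_⟩
    · rw [step_eq_nx, hstep _ a.2 q hq]
    · refine h.inj_zero (hg _ (nx_mem_core hq)) (nx_mem_core (Set.MapsTo.iterate hg b hq)) ?_
      rw [hzg _ (nx_mem_core hq), ← (h.carry q hq (g q) (hg q hq) (hzg q hq)).2,
        hstep _ (by omega) _ (hg q hq), ← Function.iterate_succ_apply]
      congr 4
      omega
  refine ⟨g, hD, ?_⟩
  rintro _ ⟨u, hu, rfl⟩ _ ⟨v, hv, rfl⟩ huv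
  -- The state u·11 depends only on g (g u), so g (g u) = g (g v) brings `inj_one` into play.
  have key : ∀ u ∈ core A, nx A 1 (nx A 1 u) = nx A 0 (nx A 0 (g^[b - 1] (g (g u)))) := by
    intro u hu
    rw [← hzg _ (nx_mem_core hu), ← hzg u hu, hD.rel _ (hg u hu),
      ← Function.iterate_succ_apply g (b - 1), Nat.succ_eq_add_one, Nat.sub_add_cancel (by omega)]
  refine h.inj_zero (hg u hu) (hg v hv) ?_
  rw [hzg u hu, hzg v hv]
  refine h.inj_one u hu v hv ?_
  rw [key u hu, key v hv, huv]

theorem upCriterion (h : LocalCriterion A) (hb : 2 ≤ b) (hinj : Function.Injective A.acceptsFrom) :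
    UPCriterion A := by
  obtain ⟨g, D, hg⟩ := h.exists_digitAction hb
  have DT := D.restrict_image hg
  have hb0 : 0 < b := by omega
  -- For a ≥ 1 the state g^a q lies in g(core), which z preserves.
  have hstep : ∀ q ∈ core A, ∀ a : Fin b, (a : ℕ) ≠ 0 → A.step q a ∈ g '' core A := by
    intro q hq a ha
    rw [D.step q hq]
    refine DT.mapsTo_z ⟨g^[(a : ℕ) - 1] q, D.mapsTo_g.iterate _ hq, ?_⟩
    rw [← Function.iterate_succ_apply' g, Nat.succ_eq_add_one, Nat.sub_add_cancel (by omega)]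
  have h1 : ∀ x : SCC A, IsType1 x → states x ⊆ g '' core A := by
    rintro x ⟨q, hq, a, ha, hqa⟩ r hr
    exact DT.mem_of_reach (hstep q (states_subset_core ⟨q, hq, a, hqa⟩ hq) a ha)
      (reach_of_mem_states hqa hr)
  have h2core : ∀ x : SCC A, IsType2 x → states x ⊆ core A := fun x hx => states_subset_core hx.1
  have h2out : ∀ x : SCC A, IsType2 x → ∀ q ∈ states x, ∀ a : Fin b, (a : ℕ) ≠ 0 →
      A.step q a ∉ states x := fun x hx q hq a ha hqa => hx.2 ⟨q, hq, a, ha, hqa⟩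
  have hz : ∀ q (a : Fin b), (a : ℕ) = 0 → A.step q a = nx A 0 q := by
    intro q a ha
    rw [step_eq_nx, ha]
  have h2z : ∀ x : SCC A, IsType2 x → ∀ q ∈ states x, nx A 0 q ∈ states x := by
    intro x hx q hq
    have hqc := h2core x hx hq
    obtain ⟨k, hk⟩ := exists_iterate_eq_of_injOn D.mapsTo_z D.injOn_z hqc
    have hr := D.reach_z hb0 (D.mapsTo_z hqc) k
    rw [← Function.iterate_succ_apply, hk] at hr
    exact mem_states_of_reach hq (D.reach_z hb0 hqc 1) hr
  have h2iter : ∀ x : SCC A, IsType2 x → ∀ q ∈ states x, ∀ r ∈ states x, ∃ k, (nx A 0)^[k] q = r := by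
    intro x hx q hq r hr
    obtain ⟨w, hw⟩ := reach_of_mem_states hq hr
    induction w generalizing q with
    | nil => exact ⟨0, hw⟩
    | cons a w ih =>
      have hqa : A.step q a ∈ states x :=
        mem_states_of_reach hq (Reach.step q a) (Reach.trans ⟨w, hw⟩ (reach_of_mem_states hr hq))
      have ha : (a : ℕ) = 0 := by
        by_contra ha
        exact h2out x hx q hq a ha hqa
      obtain ⟨k, hk⟩ := ih _ hqa hw
      exact ⟨k + 1, by rw [Function.iterate_succ_apply, ← hz q a ha, hk]⟩
  have hsurj := surjOn_of_injOn DT.mapsTo_g hg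
  -- Since g permutes g(core), this r is unique. It is the image f q under the embedding: a non-zero
  -- digit acts through g q alone, so it cannot tell q from f q.
  have hex : ∀ q ∈ core A, ∃ r ∈ g '' core A, g r = g q := fun q hq => hsurj ⟨q, hq, rfl⟩
  choose! f hf hgf using hex
  have hfstep : ∀ q ∈ core A, ∀ a : Fin b, (a : ℕ) ≠ 0 → A.step (f q) a = A.step q a := by
    intro q hq a ha
    obtain ⟨m, hm⟩ := Nat.exists_eq_succ_of_ne_zero ha
    rw [D.step q hq, DT.step _ (hf q hq), hm, Function.iterate_succ_apply,
      Function.iterate_succ_apply, hgf q hq]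
  have hfz : ∀ q ∈ core A, f (nx A 0 q) = nx A 0 (f q) := by
    intro q hq
    refine hg (hf _ (D.mapsTo_z hq)) (DT.mapsTo_z (hf q hq)) ?_
    -- As b > 0, both images under g, z (g^b q) and z (g^b (f q)), depend only on g q = g (f q).
    rw [hgf _ (D.mapsTo_z hq), D.rel q hq, DT.rel _ (hf q hq)]
    obtain ⟨m, rfl⟩ := Nat.exists_eq_succ_of_ne_zero hb0.ne'
    rw [Function.iterate_succ_apply, Function.iterate_succ_apply, hgf q hq]
  have hscc : ∀ q ∈ g '' core A, ∀ r, Reach A q r → sccOf A r = sccOf A q :=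
    fun q hq r hr => (DT.mem_states_iff hg hq).2 hr
  have h2scc : ∀ x : SCC A, IsType2 x → ∀ q ∈ states x, ∀ r ∈ states x,
      sccOf A (f r) = sccOf A (f q) := by
    intro x hx q hq r hr
    obtain ⟨k, rfl⟩ := h2iter x hx q hq r hr
    clear hr
    induction k with
    | zero => rfl
    | succ k ih =>
      have hc : (nx A 0)^[k] q ∈ core A := D.mapsTo_z.iterate k (h2core x hx hq)
      rw [Function.iterate_succ_apply', hfz _ hc, ← ih]
      exact hscc _ (hf _ hc) _ (DT.reach_z hb0 (hf _ hc) 1)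
  have h2succ : ∀ x y : SCC A, IsType2 x → IsSucc x y → ∀ q ∈ states x, y = sccOf A (f q) := by
    rintro x y hx ⟨⟨r, hr, a, ha⟩, hne⟩ q hq
    by_cases ha0 : (a : ℕ) = 0
    · rw [hz r a ha0] at ha
      exact absurd (ha.symm.trans (h2z x hx r hr)) hne
    · have hrc := h2core x hx hr
      rw [← hfstep r hrc a ha0] at ha
      rw [← h2scc x hx q hq r hr, ← hscc _ (hf r hrc) _ (Reach.step _ a)]
      exact ha.symm
  refine ⟨fun q a ha => ?_, fun x hx => ?_, fun x hx => ?_, fun x hx => ?_, fun x hx => ?_,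
    fun x y hx hy => ?_⟩
  · rw [hz q a ha]
    exact h.final q
  · obtain ⟨q, rfl⟩ := exists_mem_states x
    exact DT.isLeaf hg (h1 _ hx rfl)
  · obtain ⟨q, hq⟩ := exists_mem_states x
    obtain ⟨k, hk⟩ := exists_iterate_eq_of_injOn D.mapsTo_z D.injOn_z (h2core x hx hq)
    have hl : 0 < (nx A 0).minimalPeriod q :=
      Function.IsPeriodicPt.minimalPeriod_pos (Nat.succ_pos k) hk
    have : NeZero ((nx A 0).minimalPeriod q) := ⟨hl.ne'⟩
    have hmem : ∀ k, (nx A 0)^[k] q ∈ states x := by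
      intro k
      induction k with
      | zero => exact hq
      | succ k ih => rw [Function.iterate_succ_apply']; exact h2z x hx _ ih
    refine ⟨(nx A 0).minimalPeriod q, hl, fun i => (nx A 0)^[i.val] q, ?_, ?_, fun i a => ⟨?_, ?_⟩⟩
    · intro i j hij
      exact ZMod.val_injective _ (Function.iterate_injOn_Iio_minimalPeriod
        (Set.mem_Iio.2 (ZMod.val_lt i)) (Set.mem_Iio.2 (ZMod.val_lt j)) hij)
    · ext r
      constructor
      · rintro ⟨i, rfl⟩
        exact hmem _
      · intro hr
        obtain ⟨k, rfl⟩ := h2iter x hx q hq r hr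
        refine ⟨k, ?_⟩
        simp only [ZMod.val_natCast]
        rw [Function.iterate_mod_minimalPeriod_eq]
    · intro ha
      change A.step ((nx A 0)^[i.val] q) a = (nx A 0)^[(i + 1).val] q
      rw [hz _ a ha, ← Function.iterate_succ_apply' (nx A 0), ZMod.val_add,
        Function.iterate_mod_minimalPeriod_eq, ZMod.val_one_eq_one_mod,
        ← Function.iterate_mod_minimalPeriod_eq (f := nx A 0) (n := _ + _), Nat.add_mod_mod,
        Function.iterate_mod_minimalPeriod_eq]
    · exact h2out x hx _ (hmem _) a
  · obtain ⟨q, hq⟩ := exists_mem_states x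
    have hqc := h2core x hx hq
    refine ⟨sccOf A (f q), ⟨⟨q, hq, ⟨1, hb⟩, ?_⟩, ?_⟩, fun y hy => h2succ x y hx hy q hq,
      DT.isLeaf hg (hf q hqc)⟩
    · rw [← hfstep q hqc _ one_ne_zero]
      exact hscc _ (hf q hqc) _ (Reach.step _ _)
    · intro e
      exact hx.2 (e ▸ DT.isType1 hb hg (hf q hqc))
  · obtain ⟨q, rfl⟩ := exists_mem_states x
    exact DT.exists_pascal hb hg h.final hinj (h1 _ hx rfl)
  · have hmem : ∀ q ∈ states x, f q ∈ states y := fun q hq => (h2succ x y hx hy q hq).symm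
    -- For injectivity of f: finality is constant along a 0-circuit, f commutes with 0, and after a
    -- non-zero digit q and r have the same successor as f q = f r.
    have hlang : ∀ w : List (Fin b), ∀ q ∈ states x, ∀ r ∈ states x, f q = f r →
        (A.evalFrom q w ∈ A.accept ↔ A.evalFrom r w ∈ A.accept) := by
      intro w
      induction w with
      | nil =>
        intro q hq r hr _
        obtain ⟨k, rfl⟩ := h2iter x hx q hq r hr
        exact (DigitAction.iterate_z_mem_accept h.final k q).symm
      | cons a w ih =>
        intro q hq r hr hqr
        rw [DFA.evalFrom_cons, DFA.evalFrom_cons]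
        by_cases ha : (a : ℕ) = 0
        · rw [hz q a ha, hz r a ha]
          refine ih _ (h2z x hx q hq) _ (h2z x hx r hr) ?_
          rw [hfz q (h2core x hx hq), hfz r (h2core x hx hr), hqr]
        · rw [← hfstep q (h2core x hx hq) a ha, ← hfstep r (h2core x hx hr) a ha, hqr]
    refine ⟨fun q => ⟨f q, hmem q q.2⟩, ?_, fun q a => ⟨fun hqa => ?_, fun hqa => ?_⟩⟩
    · rintro ⟨q, hq⟩ ⟨r, hr⟩ e
      refine Subtype.ext (hinj ?_)
      ext w
      exact hlang w q hq r hr (congrArg Subtype.val e)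
    · have ha : (a : ℕ) = 0 := by
        by_contra ha
        exact h2out x hx q q.2 a ha hqa
      simp only [hz _ a ha]
      exact hfz q (h2core x hx q.2)
    · refine hfstep q (h2core x hx q.2) a fun ha => hqa ?_
      rw [hz _ a ha]
      exact h2z x hx q q.2

end LocalCriterion

/-- The UP-criterion in local form. -/
theorem upCriterion_iff_localCriterion [Finite σ] (hb : 2 ≤ b)
    (hinj : Function.Injective A.acceptsFrom) : UPCriterion A ↔ LocalCriterion A :=
  ⟨fun h => h.localCriterion hb, fun h => h.upCriterion hb hinj⟩

/-! ### Correctness and cost of programs -/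

section Machine

instance (e : Test) (s : State) : Decidable (e.Holds s) := by
  cases e <;> (unfold Test.Holds; infer_instance)

/-- The effect of a program without loops. -/
def Prog.ev : Prog → State → State
  | .skip, s => s
  | .const d c, s => s.setReg d c
  | .copy d x, s => s.setReg d (s.reg x)
  | .add d x y, s => s.setReg d (s.reg x + s.reg y)
  | .sub d x y, s => s.setReg d (s.reg x - s.reg y)
  | .load d k x, s => s.setReg d (s.arr k (s.reg x))
  | .store k x y, s => s.setArr k (s.reg x) (s.reg y)
  | .seq P Q, s => Q.ev (P.ev s)
  | .ite e P Q, s => if e.Holds s then P.ev s else Q.ev s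
  | .while _ _, s => s

/-- A program without loops that does not exceed the word bound when started in the given state. -/
def Prog.Safe (W : ℕ) : Prog → State → Prop
  | .const _ c, _ => c < W
  | .add _ x y, s => s.reg x + s.reg y < W
  | .seq P Q, s => P.Safe W s ∧ Q.Safe W (P.ev s)
  | .ite e P Q, s => if e.Holds s then P.Safe W s else Q.Safe W s
  | .while _ _, _ => False
  | _, _ => True

/-- An upper bound for the number of steps of a program without loops. -/
def Prog.size : Prog → ℕ
  | .seq P Q => P.size + Q.size
  | .ite _ P Q => P.size + Q.size + 1
  | _ => 1

theorem Prog.Safe.exec {W : ℕ} {P : Prog} {s : State} (h : P.Safe W s) :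
    ∃ t, Exec W P s t (P.ev s) ∧ t ≤ P.size := by
  induction P generalizing s with
  | skip => exact ⟨1, .skip s, le_rfl⟩
  | const d c => exact ⟨1, .const s d c h, le_rfl⟩
  | copy d x => exact ⟨1, .copy s d x, le_rfl⟩
  | add d x y => exact ⟨1, .add s d x y h, le_rfl⟩
  | sub d x y => exact ⟨1, .sub s d x y, le_rfl⟩
  | load d k x => exact ⟨1, .load s d k x, le_rfl⟩
  | store k x y => exact ⟨1, .store s k x y, le_rfl⟩
  | seq P Q ihP ihQ =>
    obtain ⟨t, ht, hle⟩ := ihP h.1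
    obtain ⟨t', ht', hle'⟩ := ihQ h.2
    exact ⟨t + t', .seq ht ht', Nat.add_le_add hle hle'⟩
  | ite e P Q ihP ihQ =>
    simp only [Prog.Safe] at h
    simp only [Prog.ev, Prog.size]
    split_ifs at h ⊢ with he
    · obtain ⟨t, ht, hle⟩ := ihP h
      exact ⟨t + 1, .ite_true he ht, by omega⟩
    · obtain ⟨t, ht, hle⟩ := ihQ h
      exact ⟨t + 1, .ite_false he ht, by omega⟩
  | _ => exact h.elim

/-- From the states satisfying `Pre`, the loop-free program `P` safely reaches states satisfying
`Post`. -/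
def Yields (W : ℕ) (P : Prog) (Pre Post : State → Prop) : Prop :=
  ∀ s, Pre s → P.Safe W s ∧ Post (P.ev s)

theorem Yields.seq {W : ℕ} {P Q : Prog} {I J K : State → Prop} (h : Yields W P I J)
    (h' : Yields W Q J K) : Yields W (.seq P Q) I K :=
  fun s hs => ⟨⟨(h s hs).1, (h' _ (h s hs).2).1⟩, (h' _ (h s hs).2).2⟩

/-- The consecutive execution of `f 0, ..., f (k - 1)`. -/
def unroll (f : ℕ → Prog) : ℕ → Prog
  | 0 => .skip
  | k + 1 => .seq (unroll f k) (f k)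

theorem Yields.unroll {W : ℕ} {f : ℕ → Prog} {I : ℕ → State → Prop} {k : ℕ}
    (h : ∀ a < k, Yields W (f a) (I a) (I (a + 1))) : Yields W (unroll f k) (I 0) (I k) := by
  induction k with
  | zero => exact fun s hs => ⟨trivial, hs⟩
  | succ k ih => exact (ih fun a ha => h a (by omega)).seq (h k (by omega))

/-- From the states satisfying `Pre`, the program `P` halts within `c` steps in a state satisfying
`Post`. -/
def Runs (W : ℕ) (P : Prog) (c : ℕ) (Pre Post : State → Prop) : Prop :=
  ∀ s, Pre s → ∃ t s', Exec W P s t s' ∧ t ≤ c ∧ Post s'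

theorem Yields.runs {W : ℕ} {P : Prog} {I J : State → Prop} (h : Yields W P I J) :
    Runs W P P.size I J := by
  intro s hs
  obtain ⟨t, ht, hle⟩ := (h s hs).1.exec
  exact ⟨t, _, ht, hle, (h s hs).2⟩

theorem Runs.seq {W c d : ℕ} {P Q : Prog} {I J K : State → Prop} (h : Runs W P c I J)
    (h' : Runs W Q d J K) : Runs W (.seq P Q) (c + d) I K := by
  intro s hs
  obtain ⟨t, s₁, ht, hle, h₁⟩ := h s hs
  obtain ⟨t', s₂, ht', hle', h₂⟩ := h' s₁ h₁
  exact ⟨_, s₂, .seq ht ht', Nat.add_le_add hle hle', h₂⟩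

/-- N only bounds the number of rounds, since the peeling loop may stop early. A round costs the
body and one test, and the last test costs one more step. -/
theorem Runs.while {W c N : ℕ} {e : Test} {P : Prog} {I : ℕ → State → Prop}
    (h : ∀ j < N, Runs W P c (fun s => I j s ∧ e.Holds s) (I (j + 1)))
    (hN : ∀ s, I N s → ¬ e.Holds s) :
    Runs W (.while e P) ((c + 1) * N + 1) (I 0) (fun s => ∃ j ≤ N, I j s ∧ ¬ e.Holds s) := by
  have key : ∀ m j, j + m = N → Runs W (.while e P) ((c + 1) * m + 1) (I j)
      (fun s => ∃ j ≤ N, I j s ∧ ¬ e.Holds s) := by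
    intro m
    induction m with
    | zero =>
      rintro j rfl s hs
      exact ⟨1, s, .while_false (hN s hs), by omega, _, le_rfl, hs, hN s hs⟩
    | succ m ih =>
      intro j hj s hs
      by_cases he : e.Holds s
      · obtain ⟨t, s₁, ht, hle, h₁⟩ := h j (by omega) s ⟨hs, he⟩
        obtain ⟨t', s₂, ht', hle', h₂⟩ := ih (j + 1) (by omega) s₁ h₁
        refine ⟨_, s₂, .while_true he ht ht', ?_, h₂⟩
        rw [Nat.mul_succ]
        omega
      · exact ⟨1, s, .while_false he, by omega, j, by omega, hs, he⟩
  exact key N 0 (Nat.zero_add N)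

/-- The counter x equals the number of rounds, so the loop cannot stop before N. -/
theorem Runs.for {W N x : ℕ} {P : Prog} {I : ℕ → State → Prop}
    (h : ∀ j < N, Yields W P (I j) (I (j + 1))) (hx : ∀ j s, I j s → s.reg x = j)
    (h0 : ∀ j s, I j s → s.reg 0 = N) :
    Runs W (.while (.lt x 0) P) ((P.size + 1) * N + 1) (I 0) (I N) := by
  intro s hs
  obtain ⟨t, s', ht, hle, j, hj, hI, he⟩ := Runs.while (W := W) (c := P.size) (N := N)
    (e := .lt x 0) (P := P) (I := I)
    (fun j hj s hs => (h j hj).runs s hs.1)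
    (fun s hs => by simp [Test.Holds, hx _ _ hs, h0 _ _ hs]) s hs
  refine ⟨t, s', ht, hle, ?_⟩
  simp only [Test.Holds, hx _ _ hI, h0 _ _ hI, not_lt] at he
  obtain rfl : j = N := le_antisymm hj he
  exact hI

@[simp] theorem State.setReg_arr (s : State) (d v : ℕ) : (s.setReg d v).arr = s.arr := rfl

@[simp] theorem State.setReg_reg_self (s : State) (d v : ℕ) : (s.setReg d v).reg d = v :=
  Function.update_self ..

@[simp] theorem State.setReg_reg_of_ne (s : State) {d x : ℕ} (v : ℕ) (h : x ≠ d) :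
    (s.setReg d v).reg x = s.reg x := Function.update_of_ne h ..

@[simp] theorem State.setArr_reg (s : State) (k i v : ℕ) : (s.setArr k i v).reg = s.reg := rfl

@[simp] theorem State.setArr_arr_self (s : State) (k i v : ℕ) :
    (s.setArr k i v).arr k = Function.update (s.arr k) i v := Function.update_self ..

@[simp] theorem State.setArr_arr_of_ne (s : State) {k l : ℕ} (i v : ℕ) (h : l ≠ k) :
    (s.setArr k i v).arr l = s.arr l := Function.update_of_ne h ..

/-- The sequential composition of a list of programs. -/
def block (l : List Prog) : Prog := l.foldr .seq .skip

@[simp] theorem ev_block_nil (s : State) : (block []).ev s = s := rfl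

@[simp] theorem ev_block_cons (P : Prog) (l : List Prog) (s : State) :
    (block (P :: l)).ev s = (block l).ev (P.ev s) := rfl

@[simp] theorem safe_block_nil (W : ℕ) (s : State) : (block []).Safe W s := trivial

@[simp] theorem safe_block_cons (W : ℕ) (P : Prog) (l : List Prog) (s : State) :
    (block (P :: l)).Safe W s ↔ P.Safe W s ∧ (block l).Safe W (P.ev s) := Iff.rfl

end Machine

/-! ### Deleting the vertices without predecessors -/

section Peeling

/-- The number of the edges `(q, a)` in `E` that lead to `r`. -/
def inCount (δ : ℕ → ℕ → ℕ) (E : Finset (ℕ × ℕ)) (r : ℕ) : ℕ := (E.filter fun e => δ e.2 e.1 = r).card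

variable {δ : ℕ → ℕ → ℕ} {E : Finset (ℕ × ℕ)} {n b : ℕ}

theorem inCount_pos {r : ℕ} : inCount δ E r ≠ 0 ↔ ∃ q a, (q, a) ∈ E ∧ δ a q = r := by
  rw [inCount, Finset.card_ne_zero, Finset.filter_nonempty_iff]
  simp

theorem inCount_insert {q a : ℕ} (h : (q, a) ∉ E) :
    inCount δ (insert (q, a) E) =
      Function.update (inCount δ E) (δ a q) (inCount δ E (δ a q) + 1) := by
  ext r
  simp only [inCount, Finset.filter_insert, Function.update_apply]
  split_ifs with h1 h2 h2
  · rw [Finset.card_insert_of_notMem (by simp [h]), h2]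
  · exact absurd h1.symm h2
  · exact absurd h2.symm h1
  · rfl

theorem inCount_erase {q a : ℕ} (h : (q, a) ∈ E) :
    inCount δ (E.erase (q, a)) =
      Function.update (inCount δ E) (δ a q) (inCount δ E (δ a q) - 1) := by
  have := inCount_insert (δ := δ) (Finset.notMem_erase (q, a) E)
  rw [Finset.insert_erase h] at this
  rw [this]
  ext r
  simp only [Function.update_apply]
  split_ifs with h1
  · rw [h1]; simp
  · rfl

/-- This keeps the counters below a linear word bound. -/
theorem inCount_le (hE : ∀ e ∈ E, e.1 < n ∧ e.2 < b) (r : ℕ) : inCount δ E r ≤ n * b := by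
  have : E ⊆ Finset.range n ×ˢ Finset.range b := fun e he => by simpa using hE e he
  calc _ ≤ E.card := Finset.card_filter_le _ _
    _ ≤ (Finset.range n ×ˢ Finset.range b).card := Finset.card_le_card this
    _ = n * b := by simp

/-- The state of the deletion of the vertices without predecessors, when the vertices
`Q 0, ..., Q (T - 1)` have been recognised as such, the edges from `Q 0, ..., Q (h - 1)` and the
first `a` edges from `Q h` have been deleted, and `cnt` counts the remaining edges to a vertex.
Every vertex of `K` has a predecessor in `K`. -/
structure Peeling (δ : ℕ → ℕ → ℕ) (n b : ℕ) (K : Set ℕ) (h a T : ℕ) (Q cnt : ℕ → ℕ) : Prop where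
  le : h ≤ T
  queue_lt : ∀ j < T, Q j < n
  queue_notMem : ∀ j < T, Q j ∉ K
  queue_inj : ∀ j < T, ∀ k < T, Q j = Q k → j = k
  edges : ∃ E : Finset (ℕ × ℕ), cnt = inCount δ E ∧ ∀ e, e ∈ E ↔ e.1 < n ∧ e.2 < b ∧
    (∀ j < h, Q j ≠ e.1) ∧ ¬ (Q h = e.1 ∧ e.2 < a)
  zero_iff : ∀ r < n, cnt r = 0 ↔ ∃ j < T, Q j = r

namespace Peeling

variable {K : Set ℕ} {h a T : ℕ} {Q cnt : ℕ → ℕ}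

/-- The queue lists distinct vertices; this bounds both the number of rounds and the register
holding its length. -/
theorem length_le (P : Peeling δ n b K h a T Q cnt) : T ≤ n := by
  have := Finset.card_le_card_of_injOn (s := Finset.range T) (t := Finset.range n) Q
    (fun j hj => by simpa using P.queue_lt j (by simpa using hj))
    (fun j hj k hk e => P.queue_inj j (by simpa using hj) k (by simpa using hk) e)
  simpa using this

theorem next (P : Peeling δ n b K h b T Q cnt) (hT : h < T) : Peeling δ n b K (h + 1) 0 T Q cnt := by
  refine ⟨hT, P.queue_lt, P.queue_notMem, P.queue_inj, ?_, P.zero_iff⟩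
  obtain ⟨E, hc, hE⟩ := P.edges
  refine ⟨E, hc, fun e => (hE e).trans ?_⟩
  constructor
  · rintro ⟨h1, h2, h3, h4⟩
    refine ⟨h1, h2, fun j hj => ?_, fun h => absurd h.2 (Nat.not_lt_zero _)⟩
    rcases Nat.lt_succ_iff_lt_or_eq.1 hj with hj | rfl
    · exact h3 j hj
    · exact fun h => h4 ⟨h, h2⟩
  · rintro ⟨h1, h2, h3, -⟩
    exact ⟨h1, h2, fun j hj => h3 j (by omega), fun h => h3 _ (by omega) h.1⟩

/-- The edge is still present because its source occurs only once in the queue. Hence the counter is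
positive and the truncated subtraction is a true one. -/
theorem edge (P : Peeling δ n b K h a T Q cnt) (hT : h < T) (ha : a < b) :
    ∃ E : Finset (ℕ × ℕ), (Function.update cnt (δ a (Q h)) (cnt (δ a (Q h)) - 1)) = inCount δ E ∧
      (∀ e, e ∈ E ↔ e.1 < n ∧ e.2 < b ∧ (∀ j < h, Q j ≠ e.1) ∧ ¬ (Q h = e.1 ∧ e.2 < a + 1)) ∧
      cnt (δ a (Q h)) ≠ 0 := by
  obtain ⟨E, hc, hE⟩ := P.edges
  have hm : (Q h, a) ∈ E := by
    refine (hE _).2 ⟨P.queue_lt h hT, ha, fun j hj e => ?_, fun h => absurd h.2 (lt_irrefl _)⟩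
    have := P.queue_inj j (by omega) h hT e
    omega
  refine ⟨E.erase (Q h, a), ?_, fun e => ?_, ?_⟩
  · rw [inCount_erase hm, hc]
  · obtain ⟨q, c⟩ := e
    rw [Finset.mem_erase, hE, Ne, Prod.mk.injEq]
    constructor
    · rintro ⟨h0, h1, h2, h3, h4⟩
      refine ⟨h1, h2, h3, fun h => ?_⟩
      rcases Nat.lt_succ_iff_lt_or_eq.1 h.2 with hl | hl
      · exact h4 ⟨h.1, hl⟩
      · exact h0 ⟨h.1.symm, hl⟩
    · rintro ⟨h1, h2, h3, h4⟩
      exact ⟨fun h => h4 ⟨h.1.symm, by simp [h.2]⟩, h1, h2, h3,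
        fun h => h4 ⟨h.1, Nat.lt_succ_of_lt h.2⟩⟩
  · rw [hc, inCount_pos]
    exact ⟨_, _, hm, rfl⟩

theorem step_of_ne (P : Peeling δ n b K h a T Q cnt) (hT : h < T) (ha : a < b)
    (h0 : cnt (δ a (Q h)) - 1 ≠ 0) :
    Peeling δ n b K h (a + 1) T Q
      (Function.update cnt (δ a (Q h)) (cnt (δ a (Q h)) - 1)) := by
  obtain ⟨E, hE, hE', h1⟩ := P.edge hT ha
  refine ⟨P.le, P.queue_lt, P.queue_notMem, P.queue_inj, ⟨E, hE, hE'⟩, fun r hr => ?_⟩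
  rw [← P.zero_iff r hr, Function.update_apply]
  split_ifs with e
  · subst e
    omega
  · rfl

/-- The new entry is not in K: a predecessor in K never enters the queue, so its edge would still be
counted. -/
theorem step_of_eq (P : Peeling δ n b K h a T Q cnt) (hT : h < T) (ha : a < b)
    (hK : ∀ r ∈ K, ∃ q ∈ K, q < n ∧ ∃ a < b, δ a q = r) (hδ : δ a (Q h) < n)
    (h0 : cnt (δ a (Q h)) - 1 = 0) :
    Peeling δ n b K h (a + 1) (T + 1) (Function.update Q T (δ a (Q h)))
      (Function.update cnt (δ a (Q h)) (cnt (δ a (Q h)) - 1)) := by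
  obtain ⟨E, hE, hE', h1⟩ := P.edge hT ha
  have hu : ∀ j < T, Function.update Q T (δ a (Q h)) j = Q j :=
    fun j hj => Function.update_of_ne hj.ne _ _
  have hnew : ∀ j < T, Q j ≠ δ a (Q h) := fun j hj e => h1 ((P.zero_iff _ hδ).2 ⟨j, hj, e⟩)
  have hcase : ∀ p : ℕ → Prop, p (δ a (Q h)) → (∀ j < T, p (Q j)) →
      ∀ j < T + 1, p (Function.update Q T (δ a (Q h)) j) := by
    intro p hp hp' j hj
    rcases Nat.lt_succ_iff_lt_or_eq.1 hj with hj | rfl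
    · rw [hu j hj]; exact hp' j hj
    · rw [Function.update_self]; exact hp
  refine ⟨P.le.trans (Nat.le_succ _), hcase (· < n) hδ P.queue_lt,
    hcase (· ∉ K) (fun hm => ?_) P.queue_notMem, ?_, ⟨E, hE, fun e => ?_⟩, fun r hr => ?_⟩
  · obtain ⟨q, hq, hqn, c, hc, hqc⟩ := hK _ hm
    have hcE : inCount δ E (δ a (Q h)) = 0 := by rw [← hE, Function.update_self, h0]
    refine inCount_pos.2 ⟨q, c, (hE' _).2 ⟨hqn, hc, fun j hj e => ?_, fun e => ?_⟩, hqc⟩ hcE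
    · exact P.queue_notMem j (by omega) (e ▸ hq)
    · exact P.queue_notMem h hT (e.1 ▸ hq)
  · intro j hj k hk e
    rcases Nat.lt_succ_iff_lt_or_eq.1 hj with hj | rfl <;>
      rcases Nat.lt_succ_iff_lt_or_eq.1 hk with hk | rfl
    · rw [hu j hj, hu k hk] at e
      exact P.queue_inj j hj k hk e
    · rw [hu j hj, Function.update_self] at e
      exact absurd e (hnew j hj)
    · rw [hu k hk, Function.update_self] at e
      exact absurd e.symm (hnew k hk)
    · rfl
  · rw [hE', hu h hT]
    refine and_congr_right fun _ => and_congr_right fun _ => and_congr_left fun _ => ?_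
    exact forall₂_congr fun j hj => by rw [hu j (by omega)]
  · rw [Function.update_apply]
    split_ifs with e
    · subst e
      exact ⟨fun _ => ⟨T, Nat.lt_succ_self T, Function.update_self ..⟩, fun _ => h0⟩
    · rw [P.zero_iff r hr]
      constructor
      · rintro ⟨j, hj, hr⟩
        exact ⟨j, by omega, by rw [hu j hj, hr]⟩
      · rintro ⟨j, hj, hr⟩
        rcases Nat.lt_succ_iff_lt_or_eq.1 hj with hj | rfl
        · exact ⟨j, hj, by rw [← hu j hj, hr]⟩
        · rw [Function.update_self] at hr
          exact absurd hr.symm e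

/-- With the queue exhausted, the remaining edges start at remaining vertices, so the survivors
satisfy the condition that defines the core. -/
theorem exists_pred (P : Peeling δ n b K T 0 T Q cnt) {r : ℕ} (hr : cnt r ≠ 0) :
    ∃ q < n, cnt q ≠ 0 ∧ ∃ a < b, δ a q = r := by
  obtain ⟨E, hc, hE⟩ := P.edges
  rw [hc, inCount_pos] at hr
  obtain ⟨q, a, hm, hr⟩ := hr
  obtain ⟨h1, h2, h3, -⟩ := (hE _).1 hm
  refine ⟨q, h1, fun h0 => ?_, a, h2, hr⟩
  obtain ⟨j, hj, e⟩ := (P.zero_iff q h1).1 h0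
  exact h3 j hj e

theorem ne_zero_of_mem (P : Peeling δ n b K h a T Q cnt) {r : ℕ} (hn : r < n) (hr : r ∈ K) :
    cnt r ≠ 0 := by
  intro h0
  obtain ⟨j, hj, rfl⟩ := (P.zero_iff r hn).1 h0
  exact P.queue_notMem j hj hr

theorem init (hE : ∀ e, e ∈ E ↔ e.1 < n ∧ e.2 < b) (hc : cnt = inCount δ E)
    (h : ∀ r < n, cnt r ≠ 0) (Q : ℕ → ℕ) : Peeling δ n b K 0 0 0 Q cnt := by
  refine ⟨le_rfl, by simp, by simp, by simp, ⟨E, hc, by simp [hE]⟩, fun r hr => ?_⟩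
  simp [h r hr]

theorem init_singleton (hE : ∀ e, e ∈ E ↔ e.1 < n ∧ e.2 < b) (hc : cnt = inCount δ E) {i : ℕ}
    (hi : i < n) (hK : ∀ r ∈ K, ∃ q ∈ K, q < n ∧ ∃ a < b, δ a q = r)
    (h : ∀ r < n, r ≠ i → cnt r ≠ 0) (h0 : cnt i = 0) (hQ : Q 0 = i) :
    Peeling δ n b K 0 0 1 Q cnt := by
  refine ⟨zero_le_one, by simp [hQ, hi], ?_, by omega, ⟨E, hc, by simp [hE]⟩, fun r hr => ?_⟩
  · intro j hj hm
    obtain rfl : j = 0 := by omega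
    rw [hQ] at hm
    obtain ⟨q, -, hq, a, ha, e⟩ := hK _ hm
    refine inCount_pos.2 ⟨q, a, (hE _).2 ⟨hq, ha⟩, e⟩ ?_
    rw [← hc, h0]
  · constructor
    · intro hr0
      refine ⟨0, zero_lt_one, ?_⟩
      by_contra hne
      exact h r hr (fun e => hne (by rw [hQ, e])) hr0
    · rintro ⟨j, hj, rfl⟩
      obtain rfl : j = 0 := by omega
      rw [hQ, h0]

end Peeling

end Peeling

/-! ### The program that computes the core -/

section Program

/-- Register 0 holds `n`, register 1 holds `i`, registers 3 and 4 hold the constants 1 and 0, and the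
arrays `0, ..., b` are those of `M`. -/
structure Frame (b n i : ℕ) (M : ℕ → ℕ → ℕ) (s : State) : Prop where
  reg_zero : s.reg 0 = n
  reg_one : s.reg 1 = i
  reg_three : s.reg 3 = 1
  reg_four : s.reg 4 = 0
  arr : ∀ k ≤ b, s.arr k = M k

variable {b n i W : ℕ} {M : ℕ → ℕ → ℕ} {s : State}

theorem Frame.setReg (h : Frame b n i M s) {d : ℕ} (v : ℕ) (hd : d = 2 ∨ 5 ≤ d) :
    Frame b n i M (s.setReg d v) := by
  refine ⟨?_, ?_, ?_, ?_, h.arr⟩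
  · rw [State.setReg_reg_of_ne _ _ (by omega), h.reg_zero]
  · rw [State.setReg_reg_of_ne _ _ (by omega), h.reg_one]
  · rw [State.setReg_reg_of_ne _ _ (by omega), h.reg_three]
  · rw [State.setReg_reg_of_ne _ _ (by omega), h.reg_four]

theorem Frame.setArr (h : Frame b n i M s) {k : ℕ} (j v : ℕ) (hk : b < k) :
    Frame b n i M (s.setArr k j v) :=
  ⟨h.reg_zero, h.reg_one, h.reg_three, h.reg_four, fun l hl => by
    rw [State.setArr_arr_of_ne _ _ _ (by omega), h.arr l hl]⟩

/-- Count the transition by the digit `a` from the state in register 2. -/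
def countDigit (b a : ℕ) : Prog :=
  block [.load 7 (a + 1) 2, .load 8 (b + 1) 7, .add 8 8 3, .store (b + 1) 7 8]

/-- Count the transitions from the state in register 2. -/
def countBody (b : ℕ) : Prog := .seq (unroll (countDigit b) b) (.add 2 2 3)

/-- The transitions from the states below `j` and the first `a` transitions from `j` are counted in
array `b + 1`. -/
structure Counted (b n i : ℕ) (M : ℕ → ℕ → ℕ) (j a : ℕ) (s : State) : Prop where
  frame : Frame b n i M s
  reg_two : s.reg 2 = j
  count : ∃ E : Finset (ℕ × ℕ), s.arr (b + 1) = inCount (fun a => M (a + 1)) E ∧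
    ∀ e, e ∈ E ↔ e.2 < b ∧ (e.1 < j ∨ e.1 = j ∧ e.2 < a)

theorem yields_countDigit (hW : n * b + n + 1 < W) {j a : ℕ} (hj : j < n) (ha : a < b) :
    Yields W (countDigit b a) (Counted b n i M j a) (Counted b n i M j (a + 1)) := by
  rintro s ⟨hF, h2, E, hE, hE'⟩
  have hle : ∀ r, inCount (fun a => M (a + 1)) E r ≤ n * b := inCount_le fun e he => by
    have := (hE' e).1 he
    omega
  have hr : s.arr (a + 1) (s.reg 2) = M (a + 1) j := by rw [hF.arr _ (by omega), h2]
  refine ⟨?_, ?_⟩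
  · simp [countDigit, Prog.Safe, Prog.ev, hF.reg_three, hr, hE]
    have := hle (M (a + 1) j)
    omega
  · refine ⟨((hF.setReg _ (by decide)).setReg _ (by decide) |>.setReg _ (by decide)).setArr _ _
      (by omega), by simp [countDigit, Prog.ev, h2], insert (j, a) E, ?_, fun e => ?_⟩
    · rw [inCount_insert (by simp [hE'])]
      simp [countDigit, Prog.ev, hF.reg_three, hr, hE]
    · rw [Finset.mem_insert, hE', Prod.ext_iff]
      simp only
      omega

theorem yields_countBody (hW : n * b + n + 1 < W) {j : ℕ} (hj : j < n) :
    Yields W (countBody b) (Counted b n i M j 0) (Counted b n i M (j + 1) 0) := by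
  refine (Yields.unroll (I := Counted b n i M j) fun a ha => yields_countDigit hW hj ha).seq ?_
  rintro s ⟨hF, h2, E, hE, hE'⟩
  refine ⟨?_, hF.setReg _ (by decide), by simp [Prog.ev, h2, hF.reg_three], E, hE,
    fun e => ?_⟩
  · simp only [Prog.Safe, h2, hF.reg_three]
    omega
  · rw [hE']
    omega

/-- Put the initial state into the queue, array `b + 2`, if it has no predecessor. -/
def pushStart (b : ℕ) : Prog :=
  block [.load 8 (b + 1) 1, .copy 2 4, .copy 5 4,
    .ite (.eq 8 4) (block [.store (b + 2) 4 1, .copy 5 3]) .skip]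

/-- The deletion of the vertices without predecessors: register 2 is the head of the queue,
register 5 its length. -/
structure Peeled (b n i : ℕ) (M : ℕ → ℕ → ℕ) (K : Set ℕ) (h a : ℕ) (s : State) : Prop where
  frame : Frame b n i M s
  reg_two : s.reg 2 = h
  peeling : Peeling (fun a => M (a + 1)) n b K h a (s.reg 5) (s.arr (b + 2)) (s.arr (b + 1))

/-- By reachability only the initial state can lack a predecessor, so no other state needs to be
tested. -/
theorem yields_pushStart {K : Set ℕ} (hi : i < n)
    (hK : ∀ r ∈ K, ∃ q ∈ K, q < n ∧ ∃ a < b, M (a + 1) q = r)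
    (hr : ∀ r < n, r ≠ i → ∃ q < n, ∃ a < b, M (a + 1) q = r) :
    Yields W (pushStart b) (Counted b n i M n 0) (Peeled b n i M K 0 0) := by
  rintro s ⟨hF, h2, E, hE, hE'⟩
  replace hE' : ∀ e, e ∈ E ↔ e.1 < n ∧ e.2 < b := fun e => by rw [hE']; omega
  have hne : ∀ r < n, r ≠ i → s.arr (b + 1) r ≠ 0 := by
    intro r hrn hri
    obtain ⟨q, hq, a, ha, e⟩ := hr r hrn hri
    rw [hE, inCount_pos]
    exact ⟨q, a, (hE' _).2 ⟨hq, ha⟩, e⟩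
  by_cases h0 : s.arr (b + 1) i = 0
  · refine ⟨by simp [pushStart, Prog.Safe, Test.Holds], ?_⟩
    have hev : (pushStart b).ev s = ((((s.setReg 8 0).setReg 2 0).setReg 5 0).setArr (b + 2) 0 i).setReg 5 1 := by
      simp [pushStart, Prog.ev, Test.Holds, h0, hF.reg_one, hF.reg_three, hF.reg_four]
    rw [hev]
    refine ⟨(((hF.setReg _ (by decide)).setReg _ (by decide)).setReg _ (by decide)
      |>.setArr _ _ (by omega)).setReg _ (by decide), by simp, ?_⟩
    simp only [State.setReg_arr, State.setReg_reg_self, State.setArr_arr_self]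
    rw [State.setArr_arr_of_ne _ _ _ (by omega)]
    exact Peeling.init_singleton hE' hE hi hK hne h0 (by simp)
  · refine ⟨by simp [pushStart, Prog.Safe, Test.Holds], ?_⟩
    have hev : (pushStart b).ev s = (((s.setReg 8 (s.arr (b + 1) i)).setReg 2 0).setReg 5 0) := by
      simp [pushStart, Prog.ev, Test.Holds, h0, hF.reg_one, hF.reg_four]
    rw [hev]
    refine ⟨((hF.setReg _ (by decide)).setReg _ (by decide)).setReg _ (by decide), by simp, ?_⟩
    simp only [State.setReg_arr, State.setReg_reg_self]
    refine Peeling.init hE' hE (fun r hrn => ?_) _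
    by_cases e : r = i
    · exact e ▸ h0
    · exact hne r hrn e

/-- Delete the transition by `a` from the state in register 6. -/
def peelDigit (b a : ℕ) : Prog :=
  block [.load 6 (b + 2) 2, .load 7 (a + 1) 6, .load 8 (b + 1) 7, .sub 8 8 3, .store (b + 1) 7 8,
    .ite (.eq 8 4) (block [.store (b + 2) 5 7, .add 5 5 3]) .skip]

/-- Delete the transitions from the head of the queue. -/
def peelBody (b : ℕ) : Prog := .seq (unroll (peelDigit b) b) (.add 2 2 3)

theorem yields_peelDigit {K : Set ℕ} (hW : n * b + n + 1 < W)
    (hK : ∀ r ∈ K, ∃ q ∈ K, q < n ∧ ∃ a < b, M (a + 1) q = r)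
    (hM : ∀ a < b, ∀ q < n, M (a + 1) q < n) {h a : ℕ} (ha : a < b) :
    Yields W (peelDigit b a) (fun s => Peeled b n i M K h a s ∧ h < s.reg 5)
      (fun s => Peeled b n i M K h (a + 1) s ∧ h < s.reg 5) := by
  rintro s ⟨⟨hF, h2, hP⟩, hT⟩
  have hr : s.arr (a + 1) (s.arr (b + 2) h) = M (a + 1) (s.arr (b + 2) h) := by
    rw [hF.arr _ (by omega)]
  have hlen := hP.length_le
  set q := s.arr (b + 2) h with hq
  set c := s.arr (b + 1) (M (a + 1) q) with hc
  refine ⟨?_, ?_⟩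
  · simp [peelDigit, Prog.Safe, Prog.ev, Test.Holds, hF.reg_three, hF.reg_four]
    omega
  have hF' := (((hF.setReg (d := 6) q (by decide)).setReg (d := 7) (M (a + 1) q) (by decide)).setReg
    (d := 8) c (by decide) |>.setReg (d := 8) (c - 1) (by decide)).setArr (k := b + 1)
      (M (a + 1) q) (c - 1) (by omega)
  by_cases h0 : c - 1 = 0
  · have hev : (peelDigit b a).ev s = ((((((s.setReg 6 q).setReg 7 (M (a + 1) q)).setReg 8
        c).setReg 8 (c - 1)).setArr (b + 1) (M (a + 1) q) (c - 1)).setArr (b + 2) (s.reg 5)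
          (M (a + 1) q)).setReg 5 (s.reg 5 + 1) := by
      simp [peelDigit, Prog.ev, Test.Holds, hF.reg_three, hF.reg_four, h2, ← hq, hr, ← hc, h0]
    rw [hev]
    refine ⟨⟨(hF'.setArr _ _ (by omega)).setReg _ (by decide), by simp [h2], ?_⟩, by simp; omega⟩
    simp only [State.setReg_arr, State.setReg_reg_self, State.setArr_arr_self]
    rw [State.setArr_arr_of_ne _ _ _ (by omega), State.setArr_arr_of_ne _ _ _ (by omega),
      State.setArr_arr_self]
    exact hP.step_of_eq hT ha hK (hM a ha _ (hP.queue_lt h hT)) h0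
  · have hev : (peelDigit b a).ev s = (((((s.setReg 6 q).setReg 7 (M (a + 1) q)).setReg 8
        c).setReg 8 (c - 1)).setArr (b + 1) (M (a + 1) q) (c - 1)) := by
      simp [peelDigit, Prog.ev, Test.Holds, hF.reg_three, hF.reg_four, h2, ← hq, hr, ← hc, h0]
    rw [hev]
    refine ⟨⟨hF', by simp [h2], ?_⟩, by simpa using hT⟩
    rw [State.setArr_arr_of_ne _ _ _ (by omega), State.setArr_arr_self]
    simpa using hP.step_of_ne hT ha h0

theorem yields_peelBody {K : Set ℕ} (hW : n * b + n + 1 < W)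
    (hK : ∀ r ∈ K, ∃ q ∈ K, q < n ∧ ∃ a < b, M (a + 1) q = r)
    (hM : ∀ a < b, ∀ q < n, M (a + 1) q < n) {h : ℕ} :
    Yields W (peelBody b) (fun s => Peeled b n i M K h 0 s ∧ h < s.reg 5)
      (Peeled b n i M K (h + 1) 0) := by
  refine (Yields.unroll (I := fun a s => Peeled b n i M K h a s ∧ h < s.reg 5)
    fun a ha => yields_peelDigit hW hK hM ha).seq ?_
  rintro s ⟨⟨hF, h2, hP⟩, hT⟩
  have hlen := hP.length_le
  refine ⟨?_, hF.setReg _ (by decide), by simp [Prog.ev, h2, hF.reg_three], ?_⟩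
  · simp only [Prog.Safe, h2, hF.reg_three]
    omega
  · simpa [Prog.ev] using hP.next hT

/-- The states of `K` are marked by non-zero entries of array `b + 1`. -/
structure Marked (b n i : ℕ) (M : ℕ → ℕ → ℕ) (K : Set ℕ) (s : State) : Prop where
  frame : Frame b n i M s
  mem_iff : ∀ r < n, s.arr (b + 1) r ≠ 0 ↔ r ∈ K

/-- `hK` ensures that no element of K is deleted, and `hK'`, the maximality of K, that nothing else
survives. -/
theorem runs_peel {K : Set ℕ} (hW : n * b + n + 1 < W)
    (hK : ∀ r ∈ K, ∃ q ∈ K, q < n ∧ ∃ a < b, M (a + 1) q = r)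
    (hK' : ∀ S : Set ℕ, (∀ r ∈ S, r < n) → (∀ r ∈ S, ∃ q ∈ S, ∃ a < b, M (a + 1) q = r) → S ⊆ K)
    (hM : ∀ a < b, ∀ q < n, M (a + 1) q < n) :
    Runs W (.while (.lt 2 5) (peelBody b)) (((peelBody b).size + 1) * n + 1)
      (Peeled b n i M K 0 0) (Marked b n i M K) := by
  intro s hs
  obtain ⟨t, s', ht, hle, h, -, ⟨hF, h2, hP⟩, he⟩ := Runs.while (W := W) (c := (peelBody b).size)
    (N := n) (e := .lt 2 5) (P := peelBody b) (I := fun h => Peeled b n i M K h 0)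
    (fun h _ s hs => (yields_peelBody hW hK hM).runs s
      ⟨hs.1, by have := hs.2; rwa [Test.Holds, hs.1.reg_two] at this⟩)
    (fun s hs => by
      have := hs.peeling.length_le
      simp only [Test.Holds, hs.reg_two]
      omega) s hs
  refine ⟨t, s', ht, hle, hF, fun r hr => ⟨fun h0 => ?_, fun hr' => hP.ne_zero_of_mem hr hr'⟩⟩
  have hT : h = s'.reg 5 := by
    have := hP.le
    simp only [Test.Holds, h2] at he
    omega
  rw [← hT] at hP
  refine hK' {r | r < n ∧ s'.arr (b + 1) r ≠ 0} (fun r hr => hr.1) (fun r hr => ?_) ⟨hr, h0⟩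
  obtain ⟨q, hq, hq0, h⟩ := hP.exists_pred hr.2
  exact ⟨q, ⟨hq, hq0⟩, h⟩

end Program

/-! ### Checking the local conditions by table lookups -/

section Verification

variable {b n i W : ℕ} {M : ℕ → ℕ → ℕ} {K : Set ℕ}

/-- If the state `j` in register 2 is marked, then record it in array `b + 3` as the predecessor by 0
of `j · 0`, and record `j · 1` in array `b + 4` as the predecessor by 1 of `j · 1 · 1`. -/
def fillBody (b : ℕ) : Prog :=
  block [.load 8 (b + 1) 2,
    .ite (.eq 8 4) .skip
      (block [.load 7 1 2, .store (b + 3) 7 2, .load 7 2 2, .load 8 2 7, .store (b + 4) 8 7]),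
    .add 2 2 3]

/-- The marked states below `j` have been treated by `fillBody`. -/
structure Filled (b n i : ℕ) (M : ℕ → ℕ → ℕ) (K : Set ℕ) (j : ℕ) (s : State) : Prop where
  marked : Marked b n i M K s
  reg_two : s.reg 2 = j
  pred_zero : ∀ k < j, k ∈ K → ∃ l < n, l ∈ K ∧ s.arr (b + 3) (M 1 k) = l ∧ M 1 l = M 1 k
  pred_one : ∀ k < j, k ∈ K → ∃ l < n, l ∈ K ∧ s.arr (b + 4) (M 2 (M 2 k)) = M 2 l ∧
    M 2 (M 2 l) = M 2 (M 2 k)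

/-- A later state may overwrite a cell, so the invariant claims only that the cell records some
marked state with the same image; this suffices for testing injectivity. -/
theorem yields_fillBody (hb : 2 ≤ b) (hW : n * b + n + 1 < W) {j : ℕ} (hj : j < n) :
    Yields W (fillBody b) (Filled b n i M K j) (Filled b n i M K (j + 1)) := by
  rintro s ⟨⟨hF, hm⟩, h2, hp0, hp1⟩
  have e1 : s.arr 1 = M 1 := hF.arr 1 (by omega)
  have e2 : s.arr 2 = M 2 := hF.arr 2 (by omega)
  by_cases h0 : s.arr (b + 1) j = 0
  · have hjK : j ∉ K := fun h => (hm j hj).2 h h0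
    have hev : (fillBody b).ev s = (s.setReg 8 0).setReg 2 (j + 1) := by
      simp [fillBody, Prog.ev, Test.Holds, h2, h0, hF.reg_three, hF.reg_four]
    refine ⟨?_, ?_⟩
    · simp [fillBody, Prog.Safe, Prog.ev, Test.Holds, h2, h0, hF.reg_three, hF.reg_four]
      omega
    rw [hev]
    have hlt : ∀ k < j + 1, k ∈ K → k < j := fun k hk hkK =>
      lt_of_le_of_ne (Nat.lt_succ_iff.1 hk) (fun e => hjK (e ▸ hkK))
    exact ⟨⟨(hF.setReg _ (by decide)).setReg _ (by decide), hm⟩, by simp,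
      fun k hk hkK => hp0 k (hlt k hk hkK) hkK, fun k hk hkK => hp1 k (hlt k hk hkK) hkK⟩
  · have hjK : j ∈ K := (hm j hj).1 h0
    have hev : (fillBody b).ev s = (((((((s.setReg 8 (s.arr (b + 1) j)).setReg 7 (M 1 j)).setArr
        (b + 3) (M 1 j) j).setReg 7 (M 2 j)).setReg 8 (M 2 (M 2 j))).setArr
          (b + 4) (M 2 (M 2 j)) (M 2 j))).setReg 2 (j + 1) := by
      simp [fillBody, Prog.ev, Test.Holds, h2, h0, hF.reg_three, hF.reg_four, e1, e2]
    refine ⟨?_, ?_⟩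
    · simp [fillBody, Prog.Safe, Prog.ev, Test.Holds, h2, h0, hF.reg_three, hF.reg_four]
      omega
    rw [hev]
    refine ⟨⟨((((((hF.setReg _ (by decide)).setReg _ (by decide)).setArr _ _ (by omega)).setReg _
      (by decide)).setReg _ (by decide)).setArr _ _ (by omega)).setReg _ (by decide), ?_⟩,
      by simp, ?_, ?_⟩
    · intro r hr
      simp only [State.setReg_arr]
      rw [State.setArr_arr_of_ne _ _ _ (by omega)]
      simp only [State.setReg_arr]
      rw [State.setArr_arr_of_ne _ _ _ (by omega)]
      exact hm r hr
    · intro k hk hkK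
      simp only [State.setReg_arr]
      rw [State.setArr_arr_of_ne _ _ _ (by omega)]
      simp only [State.setReg_arr, State.setArr_arr_self, Function.update_apply]
      split_ifs with e
      · exact ⟨j, hj, hjK, rfl, e.symm⟩
      · exact hp0 k (lt_of_le_of_ne (Nat.lt_succ_iff.1 hk) (fun h => e (h ▸ rfl))) hkK
    · intro k hk hkK
      simp only [State.setReg_arr, State.setArr_arr_self, Function.update_apply]
      rw [State.setArr_arr_of_ne _ _ _ (by omega)]
      split_ifs with e
      · exact ⟨j, hj, hjK, rfl, e.symm⟩
      · exact hp1 k (lt_of_le_of_ne (Nat.lt_succ_iff.1 hk) (fun h => e (h ▸ rfl))) hkK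

/-- Register 9 records whether `p` is true. -/
def Flag (p : Prop) (s : State) : Prop := (p → s.reg 9 = 1) ∧ (¬ p → s.reg 9 = 0)

/-- Clear register 9 unless the registers `x` and `y` are equal. -/
def check (x y : ℕ) : Prog := .ite (.eq x y) .skip (.copy 9 4)

/-- The contents of the memory while the conditions are checked for the state `j`. -/
structure Checking (n : ℕ) (R : ℕ → ℕ → ℕ) (j : ℕ) (p : Prop) (s : State) : Prop where
  arr : s.arr = R
  reg_zero : s.reg 0 = n
  reg_two : s.reg 2 = j
  reg_three : s.reg 3 = 1
  reg_four : s.reg 4 = 0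
  flag : Flag p s

variable {R : ℕ → ℕ → ℕ} {j : ℕ} {p : Prop} {s : State}

theorem Checking.setReg (h : Checking n R j p s) {d : ℕ} (v : ℕ) (hd : 5 ≤ d) (hd' : d ≠ 9) :
    Checking n R j p (s.setReg d v) := by
  refine ⟨h.arr, ?_, ?_, ?_, ?_, ?_⟩
  · rw [State.setReg_reg_of_ne _ _ (by omega), h.reg_zero]
  · rw [State.setReg_reg_of_ne _ _ (by omega), h.reg_two]
  · rw [State.setReg_reg_of_ne _ _ (by omega), h.reg_three]
  · rw [State.setReg_reg_of_ne _ _ (by omega), h.reg_four]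
  · rw [Flag, State.setReg_reg_of_ne _ _ hd'.symm]
    exact h.flag

theorem Checking.congr {p' : Prop} (h : Checking n R j p s) (e : p ↔ p') :
    Checking n R j p' s := (propext e : p = p') ▸ h

theorem Checking.check (h : Checking n R j p s) (x y : ℕ) :
    Checking n R j (p ∧ s.reg x = s.reg y) ((check x y).ev s) ∧
      ∀ d ≠ 9, ((UPC.check x y).ev s).reg d = s.reg d := by
  by_cases e : s.reg x = s.reg y
  · have hev : (UPC.check x y).ev s = s := if_pos e
    rw [hev]
    exact ⟨h.congr (by simp [e]), fun _ _ => rfl⟩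
  · have hev : (UPC.check x y).ev s = s.setReg 9 (s.reg 4) := if_neg e
    rw [hev]
    refine ⟨⟨h.arr, ?_, ?_, ?_, ?_, ?_⟩, fun d hd => State.setReg_reg_of_ne _ _ hd⟩
    · rw [State.setReg_reg_of_ne _ _ (by omega), h.reg_zero]
    · rw [State.setReg_reg_of_ne _ _ (by omega), h.reg_two]
    · rw [State.setReg_reg_of_ne _ _ (by omega), h.reg_three]
    · rw [State.setReg_reg_of_ne _ _ (by omega), h.reg_four]
    · exact ⟨fun hp => absurd hp.2 e, fun _ => by rw [State.setReg_reg_self, h.reg_four]⟩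

@[simp] theorem safe_check (x y : ℕ) : (check x y).Safe W s := by
  simp [check, Prog.Safe]

/-- Compare the successor by `a + 1` of the state in register 2 with the successor by `a` of the
state in register 6. -/
def checkDigit (a : ℕ) : Prog := block [.load 8 (a + 2) 2, .load 10 (a + 1) 6, check 8 10]

theorem yields_checkDigit {r a : ℕ} {c : ℕ → Prop}
    (hc : c a ↔ R (a + 2) j = R (a + 1) r) :
    Yields W (checkDigit a)
      (fun s => Checking n R j (p ∧ ∀ k < a, c k) s ∧ s.reg 6 = r)
      (fun s => Checking n R j (p ∧ ∀ k < a + 1, c k) s ∧ s.reg 6 = r) := by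
  rintro s ⟨h, h6⟩
  refine ⟨by simp [checkDigit, Prog.Safe], ?_⟩
  simp only [checkDigit, ev_block_cons, ev_block_nil]
  have h1 := (h.setReg (d := 8) (s.arr (a + 2) (s.reg 2)) (by decide) (by decide)).setReg (d := 10)
    (s.arr (a + 1) (s.reg 6)) (by decide) (by decide)
  obtain ⟨h2, h3⟩ := h1.check 8 10
  refine ⟨h2.congr ?_, (h3 6 (by decide)).trans (by simp [h6])⟩
  simp only [State.setReg_reg_self]
  rw [State.setReg_reg_of_ne _ _ (by decide), State.setReg_reg_self, h.arr, h.reg_two, h6, ← hc,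
    and_assoc, Nat.forall_lt_succ_right]

/-- The conditions on the state `j` in terms of the contents of the arrays. -/
def Cond (b : ℕ) (R : ℕ → ℕ → ℕ) (j : ℕ) : Prop :=
  R 0 (R 1 j) = R 0 j ∧ (R (b + 1) j ≠ 0 → R (b + 3) (R 1 j) = j ∧
    R (b + 4) (R 2 (R 2 j)) = R 2 j ∧
    (∀ a < b - 1, R (a + 2) j = R (a + 1) (R (b + 3) (R 2 j))) ∧
    R 1 (R b (R (b + 3) (R 2 j))) = R 2 (R 1 j))

/-- Check the conditions on the marked state in register 2. -/
def checkMarked (b : ℕ) : Prog :=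
  .seq
    (block [.load 8 (b + 3) 7, check 8 2, .load 7 2 2, .load 8 2 7, .load 8 (b + 4) 8, check 8 7,
      .load 6 (b + 3) 7])
    (.seq (unroll checkDigit (b - 1))
      (block [.load 8 b 6, .load 8 1 8, .load 10 1 2, .load 10 2 10, check 8 10]))

/-- Check the conditions on the state in register 2. -/
def checkBody (b : ℕ) : Prog :=
  .seq (block [.load 7 1 2, .load 8 0 7, .load 10 0 2, check 8 10, .load 8 (b + 1) 2])
    (.seq (.ite (.eq 8 4) .skip (checkMarked b)) (.add 2 2 3))

theorem yields_checkMarked :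
    Yields W (checkMarked b) (fun s => Checking n R j p s ∧ s.reg 7 = R 1 j)
      (Checking n R j (((p ∧ R (b + 3) (R 1 j) = j) ∧ R (b + 4) (R 2 (R 2 j)) = R 2 j) ∧
        (∀ a < b - 1, R (a + 2) j = R (a + 1) (R (b + 3) (R 2 j))) ∧
        R 1 (R b (R (b + 3) (R 2 j))) = R 2 (R 1 j))) := by
  refine Yields.seq (J := fun s => Checking n R j (((p ∧ R (b + 3) (R 1 j) = j) ∧
    R (b + 4) (R 2 (R 2 j)) = R 2 j) ∧ ∀ a < 0, R (a + 2) j = R (a + 1) (R (b + 3) (R 2 j))) s ∧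
      s.reg 6 = R (b + 3) (R 2 j)) ?_ ?_
  · rintro s ⟨h, h7⟩
    refine ⟨by simp [Prog.Safe], ?_⟩
    simp only [ev_block_cons, ev_block_nil]
    obtain ⟨h1, g1⟩ := (h.setReg (d := 8) (s.arr (b + 3) (s.reg 7)) (by decide)
      (by decide)).check 8 2
    rw [State.setReg_reg_self, State.setReg_reg_of_ne _ _ (by decide), h.arr, h.reg_two, h7] at h1
    have e : ((check 8 2).ev ((Prog.load 8 (b + 3) 7).ev s)) =
      ((check 8 2).ev (s.setReg 8 (s.arr (b + 3) (s.reg 7)))) := rfl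
    rw [e, h.arr, h7]
    generalize (check 8 2).ev (s.setReg 8 (R (b + 3) (R 1 j))) = s₁ at h1
    obtain ⟨h2, g2⟩ := (((h1.setReg (d := 7) (R 2 j) (by decide) (by decide)).setReg (d := 8)
      (R 2 (R 2 j)) (by decide) (by decide)).setReg (d := 8) (R (b + 4) (R 2 (R 2 j))) (by decide)
        (by decide)).check 8 7
    have e : (Prog.load 8 (b + 4) 8).ev ((Prog.load 8 2 7).ev ((Prog.load 7 2 2).ev s₁)) =
        ((s₁.setReg 7 (R 2 j)).setReg 8 (R 2 (R 2 j))).setReg 8 (R (b + 4) (R 2 (R 2 j))) := by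
      simp [Prog.ev, h1.arr, h1.reg_two]
    rw [e]
    have g3 := g2 7 (by decide)
    simp only [State.setReg_reg_self] at h2
    simp at g3
    rw [State.setReg_reg_of_ne _ _ (by decide), State.setReg_reg_of_ne _ _ (by decide),
      State.setReg_reg_self] at h2
    generalize (check 8 7).ev _ = s₂ at h2 g3
    refine ⟨(h2.setReg (d := 6) (s₂.arr (b + 3) (s₂.reg 7)) (by decide) (by decide)).congr
      (by simp), ?_⟩
    simp [Prog.ev, h2.arr, g3]
  · refine (Yields.unroll (k := b - 1) (I := fun k s => Checking n R j
      (((p ∧ R (b + 3) (R 1 j) = j) ∧ R (b + 4) (R 2 (R 2 j)) = R 2 j) ∧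
        ∀ a < k, R (a + 2) j = R (a + 1) (R (b + 3) (R 2 j))) s ∧ s.reg 6 = R (b + 3) (R 2 j))
          fun a ha => yields_checkDigit Iff.rfl).seq ?_
    rintro s ⟨h, h6⟩
    refine ⟨by simp [Prog.Safe], ?_⟩
    simp only [ev_block_cons, ev_block_nil]
    have e : (Prog.load 10 2 10).ev ((Prog.load 10 1 2).ev ((Prog.load 8 1 8).ev
        ((Prog.load 8 b 6).ev s))) = (((s.setReg 8 (R b (R (b + 3) (R 2 j)))).setReg 8
          (R 1 (R b (R (b + 3) (R 2 j))))).setReg 10 (R 1 j)).setReg 10 (R 2 (R 1 j)) := by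
      simp [Prog.ev, h.arr, h.reg_two, h6]
    rw [e]
    obtain ⟨h1, -⟩ := ((((h.setReg (d := 8) (R b (R (b + 3) (R 2 j))) (by decide)
      (by decide)).setReg (d := 8) (R 1 (R b (R (b + 3) (R 2 j)))) (by decide) (by decide)).setReg
        (d := 10) (R 1 j) (by decide) (by decide)).setReg (d := 10) (R 2 (R 1 j)) (by decide)
          (by decide)).check 8 10
    refine h1.congr ?_
    simp [and_assoc]

theorem yields_checkBody (hW : n * b + n + 1 < W) (hj : j < n) :
    Yields W (checkBody b) (Checking n R j (∀ k < j, Cond b R k))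
      (Checking n R (j + 1) (∀ k < j + 1, Cond b R k)) := by
  refine Yields.seq (J := fun s => Checking n R j ((∀ k < j, Cond b R k) ∧ R 0 (R 1 j) = R 0 j) s ∧
    s.reg 7 = R 1 j ∧ s.reg 8 = R (b + 1) j) ?_
    (Yields.seq (J := Checking n R j (∀ k < j + 1, Cond b R k)) ?_ ?_)
  · intro s h
    refine ⟨by simp [Prog.Safe], ?_⟩
    simp only [ev_block_cons, ev_block_nil]
    have e : (Prog.load 10 0 2).ev ((Prog.load 8 0 7).ev ((Prog.load 7 1 2).ev s)) =
        ((s.setReg 7 (R 1 j)).setReg 8 (R 0 (R 1 j))).setReg 10 (R 0 j) := by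
      simp [Prog.ev, h.arr, h.reg_two]
    rw [e]
    obtain ⟨h1, g1⟩ := (((h.setReg (d := 7) (R 1 j) (by decide) (by decide)).setReg (d := 8)
      (R 0 (R 1 j)) (by decide) (by decide)).setReg (d := 10) (R 0 j) (by decide)
        (by decide)).check 8 10
    have g7 := g1 7 (by decide)
    simp at g7 h1
    generalize (check 8 10).ev _ = s₁ at h1 g7
    refine ⟨h1.setReg (d := 8) _ (by decide) (by decide), ?_, ?_⟩
    · simp [Prog.ev, g7]
    · simp [Prog.ev, h1.arr, h1.reg_two]
  · rintro s ⟨h, h7, h8⟩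
    simp only [Prog.Safe, Prog.ev, Test.Holds, h8, h.reg_four]
    split_ifs with h0
    · refine ⟨trivial, h.congr ?_⟩
      rw [Nat.forall_lt_succ_right, Cond]
      simp [h0]
    · obtain ⟨g, g'⟩ := yields_checkMarked (W := W) (b := b) s ⟨h, h7⟩
      refine ⟨g, g'.congr ?_⟩
      rw [Nat.forall_lt_succ_right, Cond]
      simp only [ne_eq, h0, not_false_eq_true, forall_const, and_assoc]
  · intro s h
    refine ⟨?_, h.arr, ?_, ?_, ?_, ?_, ?_⟩
    · simp only [Prog.Safe, h.reg_two, h.reg_three]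
      omega
    · simp [Prog.ev, h.reg_zero]
    · simp [Prog.ev, h.reg_two, h.reg_three]
    · simp [Prog.ev, h.reg_three]
    · simp [Prog.ev, h.reg_four]
    · simpa [Prog.ev, Flag] using h.flag

end Verification

/-! ### Correctness and running time of the decision program -/

section Decision

variable {b n : ℕ} {A : DFA (Fin b) (Fin n)}

theorem input_arr_succ {a : ℕ} (ha : a < b) (q : Fin n) :
    (input A).arr (a + 1) q = ↑(nx A a q) := by
  simp [input, nx, ha]

open Classical in
theorem input_arr_zero (q : Fin n) : (input A).arr 0 q = if q ∈ A.accept then 1 else 0 := by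
  simp [input]

/-- If every marked state reads back its own entry, states with equal images coincide; conversely,
injectivity forces the recorded entry to be the right one. Cells never written do no harm: `carry`
concerns only cells r·0 with r in the core, and under the local criterion every q·1 with q in the
core is of this form. -/
theorem forall_cond_iff (hb : 2 ≤ b) {i : ℕ} {s : State}
    (h : Filled b n i (input A).arr (Fin.val '' core A) n s) :
    (∀ k < n, Cond b s.arr k) ↔ LocalCriterion A := by
  classical
  obtain ⟨⟨hF, hm⟩, -, h0, h1⟩ := h
  have e0 : ∀ q : Fin n, s.arr 0 q = if q ∈ A.accept then 1 else 0 := fun q => by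
    rw [hF.arr 0 (by omega), input_arr_zero]
  have ea : ∀ a < b, ∀ q : Fin n, s.arr (a + 1) q = ↑(nx A a q) := fun a ha q => by
    rw [hF.arr _ (by omega), input_arr_succ ha]
  have ez : ∀ q : Fin n, s.arr 1 q = nx A 0 q := ea 0 (by omega)
  have eo : ∀ q : Fin n, s.arr 2 q = nx A 1 q := ea 1 (by omega)
  have el : ∀ q : Fin n, s.arr b q = nx A (b - 1) q := fun q => by
    have := ea (b - 1) (by omega) q
    rwa [Nat.sub_add_cancel (by omega)] at this
  have em : ∀ q : Fin n, s.arr (b + 1) q ≠ 0 ↔ q ∈ core A := fun q => by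
    rw [hm q q.2, Fin.val_injective.mem_set_image]
  have p0 : ∀ q ∈ core A, ∃ l : Fin n, l ∈ core A ∧ s.arr (b + 3) ↑(nx A 0 q) = (l : ℕ) ∧ nx A 0 l = nx A 0 q := by
    intro q hq
    obtain ⟨_, -, ⟨l, hl, rfl⟩, h2, h3⟩ := h0 q q.2 ⟨q, hq, rfl⟩
    rw [← hF.arr 1 (by omega), ez, ez] at h3
    rw [← hF.arr 1 (by omega), ez] at h2
    exact ⟨l, hl, h2, Fin.ext h3⟩
  have p1 : ∀ q ∈ core A, ∃ l : Fin n, l ∈ core A ∧ s.arr (b + 4) ↑(nx A 1 (nx A 1 q)) = ↑(nx A 1 l) ∧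
      nx A 1 (nx A 1 l) = nx A 1 (nx A 1 q) := by
    intro q hq
    obtain ⟨_, -, ⟨l, hl, rfl⟩, h2, h3⟩ := h1 q q.2 ⟨q, hq, rfl⟩
    rw [← hF.arr 2 (by omega), eo, eo, eo, eo] at h3
    rw [← hF.arr 2 (by omega), eo, eo, eo] at h2
    exact ⟨l, hl, h2, Fin.ext h3⟩
  have hcond : ∀ q : Fin n, Cond b s.arr q ↔ (nx A 0 q ∈ A.accept ↔ q ∈ A.accept) ∧
      (q ∈ core A → s.arr (b + 3) ↑(nx A 0 q) = q ∧
        s.arr (b + 4) ↑(nx A 1 (nx A 1 q)) = ↑(nx A 1 q) ∧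
        (∀ a < b - 1, ↑(nx A (a + 1) q) = s.arr (a + 1) (s.arr (b + 3) ↑(nx A 1 q))) ∧
        s.arr 1 (s.arr b (s.arr (b + 3) ↑(nx A 1 q))) = ↑(nx A 1 (nx A 0 q))) := by
    intro q
    rw [Cond, em, ez, eo, eo, eo, e0, e0]
    refine and_congr ?_ (imp_congr_right fun _ => and_congr_right fun _ => and_congr_right fun _ =>
      and_congr_left fun _ => forall₂_congr fun a ha => by rw [ea (a + 1) (by omega)])
    split_ifs <;> simp [*]
  constructor
  · intro hc
    replace hc := fun q : Fin n => (hcond q).1 (hc q q.2)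
    refine ⟨fun q => (hc q).1, fun q hq r hr e => ?_, fun q hq r hr e => ?_,
      fun q hq r hr e => ?_⟩
    · have h1 := ((hc q).2 hq).1
      rw [e, ((hc r).2 hr).1] at h1
      exact (Fin.ext h1).symm
    · have h1 := ((hc q).2 hq).2.1
      rw [e, ((hc r).2 hr).2.1] at h1
      exact (Fin.ext h1).symm
    · obtain ⟨-, -, h2, h3⟩ := (hc q).2 hq
      rw [← e, ((hc r).2 hr).1] at h2 h3
      rw [el, ez] at h3
      refine ⟨fun a ha => Fin.ext ?_, Fin.ext h3⟩
      rw [h2 a (by omega), ea a (by omega)]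
  · intro L k hk
    refine (hcond ⟨k, hk⟩).2 ⟨L.final _, fun hq => ?_⟩
    have hz : ∀ q ∈ core A, s.arr (b + 3) ↑(nx A 0 q) = q := by
      intro q hq
      obtain ⟨l, hl, h1, h2⟩ := p0 q hq
      rw [h1, L.inj_zero hl hq h2]
    generalize (⟨k, hk⟩ : Fin n) = q at hq
    obtain ⟨r, hr, e⟩ := surjOn_of_injOn (fun q hq => nx_mem_core hq) L.inj_zero
      (nx_mem_core (a := 1) hq)
    obtain ⟨c1, c2⟩ := L.carry q hq r hr e
    rw [← e, hz q hq, hz r hr, el, ez, c2]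
    refine ⟨rfl, ?_, fun a ha => ?_, rfl⟩
    · obtain ⟨l, hl, h1, h2⟩ := p1 q hq
      rw [e, h1, L.inj_one l hl q hq h2]
    · rw [ea a (by omega), c1 a (by omega)]

/-- A program that decides the UP-criterion. -/
def decideUP (b : ℕ) : Prog :=
  .seq (.const 3 1) (.seq (.while (.lt 2 0) (countBody b)) (.seq (pushStart b)
    (.seq (.while (.lt 2 5) (peelBody b)) (.seq (.copy 2 4)
      (.seq (.while (.lt 2 0) (fillBody b)) (.seq (block [.copy 2 4, .copy 9 3])
        (.seq (.while (.lt 2 0) (checkBody b)) (.copy 0 9))))))))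

theorem exists_runs_decideUP (hb : 2 ≤ b) : ∃ c d : ℕ, ∀ (n : ℕ) (A : DFA (Fin b) (Fin n)),
    IsMinimal A → ∀ W, n * b + n + 1 < W → Runs W (decideUP b) (c * n + d) (· = input A)
      (fun s => (UPCriterion A → s.reg 0 = 1) ∧ (¬ UPCriterion A → s.reg 0 = 0)) := by
  -- The 4 pays for one test per round in each of the four loops; the 7 for their four failing tests
  -- and three single instructions.
  refine ⟨(countBody b).size + (peelBody b).size + (fillBody b).size + (checkBody b).size + 4,
    (pushStart b).size + (block [.copy 2 4, .copy 9 3]).size + 7, fun n A hA W hW => ?_⟩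
  rw [upCriterion_iff_localCriterion hb hA.2]
  set M := (input A).arr
  set K := Fin.val '' core A with hKdef
  have hstart : (A.start : ℕ) < n := A.start.2
  have hM : ∀ a < b, ∀ q < n, M (a + 1) q < n := fun a ha q hq => by
    have := input_arr_succ (A := A) ha ⟨q, hq⟩
    exact this.trans_lt (Fin.is_lt _)
  have hK : ∀ r ∈ K, ∃ q ∈ K, q < n ∧ ∃ a < b, M (a + 1) q = r := by
    rintro _ ⟨r, hr, rfl⟩
    obtain ⟨q, hq, a, rfl⟩ := exists_pred_core hr
    exact ⟨q, ⟨q, hq, rfl⟩, q.2, a, a.2, by rw [step_eq_nx]; exact input_arr_succ a.2 q⟩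
  have hK' : ∀ S : Set ℕ, (∀ r ∈ S, r < n) → (∀ r ∈ S, ∃ q ∈ S, ∃ a < b, M (a + 1) q = r) →
      S ⊆ K := by
    intro S hS h r hr
    refine ⟨⟨r, hS r hr⟩, subset_core (S := {q : Fin n | (q : ℕ) ∈ S}) (fun q hq => ?_) hr, rfl⟩
    obtain ⟨p, hp, a, ha, e⟩ := h q hq
    refine ⟨⟨p, hS p hp⟩, hp, ⟨a, ha⟩, Fin.ext ?_⟩
    rw [step_eq_nx, ← e]
    exact (input_arr_succ ha _).symm
  have hreach : ∀ r < n, r ≠ A.start → ∃ q < n, ∃ a < b, M (a + 1) q = r := by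
    intro r hr hne
    obtain ⟨w, hw⟩ := hA.1 ⟨r, hr⟩
    rcases List.eq_nil_or_concat w with rfl | ⟨v, a, rfl⟩
    · exact absurd (congrArg Fin.val hw).symm hne
    · refine ⟨A.eval v, Fin.is_lt _, a, a.2, (input_arr_succ a.2 _).trans ?_⟩
      rw [← step_eq_nx]
      simpa using congrArg Fin.val hw
  have hconst : Yields W (.const 3 1) (· = input A) (Counted b n A.start M 0 0) := by
    rintro _ rfl
    refine ⟨?_, ⟨?_, ?_, ?_, ?_, fun _ _ => rfl⟩, ?_, ∅, ?_, ?_⟩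
    · simp only [Prog.Safe]
      omega
    · simp [Prog.ev, input]
    · simp [Prog.ev, input]
    · simp [Prog.ev]
    · simp [Prog.ev, input]
    · simp [Prog.ev, input]
    · ext r
      simp [Prog.ev, input, inCount]
    · simp
  have hcount := Runs.for (W := W) (N := n) (x := 2) (P := countBody b)
    (I := fun j => Counted b n A.start M j 0) (fun j hj => yields_countBody hW hj)
    (fun _ _ h => h.reg_two) (fun _ _ h => h.frame.reg_zero)
  have hpush := (yields_pushStart (W := W) hstart hK hreach).runs
  have hpeel := runs_peel (i := A.start) hW hK hK' hM
  have hcopy : Yields W (.copy 2 4) (Marked b n A.start M K) (Filled b n A.start M K 0) := by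
    intro s hs
    refine ⟨trivial, ⟨hs.frame.setReg _ (by decide), hs.mem_iff⟩, ?_, by simp, by simp⟩
    simp [Prog.ev, hs.frame.reg_four]
  have hfill := Runs.for (W := W) (N := n) (x := 2) (P := fillBody b)
    (I := fun j => Filled b n A.start M K j) (fun j hj => yields_fillBody hb hW hj)
    (fun _ _ h => h.reg_two) (fun _ _ h => h.marked.frame.reg_zero)
  have hflag : Yields W (block [.copy 2 4, .copy 9 3]) (Filled b n A.start M K n)
      (fun s => ∃ s₀, Filled b n A.start M K n s₀ ∧
        Checking n s₀.arr 0 (∀ k < 0, Cond b s₀.arr k) s) := by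
    intro s hs
    have hF := hs.marked.frame
    refine ⟨by simp [Prog.Safe], s, hs, rfl, ?_, ?_, ?_, ?_, ?_, ?_⟩ <;>
      simp [Prog.ev, hF.reg_zero, hF.reg_three, hF.reg_four]
  have hcheck : Runs W (.while (.lt 2 0) (checkBody b)) (((checkBody b).size + 1) * n + 1)
      (fun s => ∃ s₀, Filled b n A.start M K n s₀ ∧
        Checking n s₀.arr 0 (∀ k < 0, Cond b s₀.arr k) s) (Flag (LocalCriterion A)) := by
    rintro s ⟨s₀, hs₀, hs⟩
    obtain ⟨t, s', ht, hle, h⟩ := Runs.for (W := W) (N := n) (x := 2) (P := checkBody b)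
      (I := fun j => Checking n s₀.arr j (∀ k < j, Cond b s₀.arr k))
      (fun j hj => yields_checkBody hW hj) (fun _ _ h => h.reg_two) (fun _ _ h => h.reg_zero) s hs
    exact ⟨t, s', ht, hle, (h.congr (forall_cond_iff hb hs₀)).flag⟩
  have hout : Yields W (.copy 0 9) (Flag (LocalCriterion A))
      (fun s => (LocalCriterion A → s.reg 0 = 1) ∧ (¬ LocalCriterion A → s.reg 0 = 0)) :=
    fun s hs => ⟨trivial, by simpa [Prog.ev, Flag] using hs⟩
  intro s hs
  obtain ⟨t, s', ht, hle, h⟩ := (hconst.runs.seq (hcount.seq (hpush.seq (hpeel.seq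
    (hcopy.runs.seq (hfill.seq (hflag.runs.seq (hcheck.seq hout.runs)))))))) s hs
  refine ⟨t, s', ht, hle.trans (le_of_eq ?_), h⟩
  simp only [Prog.size]
  ring

end Decision

end UPC

theorem theoremt (b : ℕ) (hb : 2 ≤ b) :
    UPC.LinearTimeOnMinimal b (fun {_n} A => UPC.UPCriterion A) := by
  obtain ⟨c, d, h⟩ := UPC.exists_runs_decideUP hb
  refine ⟨UPC.decideUP b, b + c + d + 3, fun n A hA => ?_⟩
  -- The initial state makes n positive, so additive constants are absorbed into a multiple of n.
  have hn : 0 < n := A.start.pos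
  have hW : n * b + n + 1 < (b + c + d + 3) * n := by
    nlinarith [Nat.zero_le (c * n), Nat.zero_le (d * n)]
  obtain ⟨t, s, ht, hle, hs⟩ := h n A hA _ hW _ rfl
  exact ⟨t, s, ht, by nlinarith [Nat.zero_le (b * n), Nat.mul_le_mul_left d hn], hs⟩
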